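/- **Setting.** Let $N_x,N_y\ge 1$, $N=N_xN_y$, $K_1,K_2\ge 0$, $K=K_1+K_2<N$, $L\ge 1$, $\lambda>0$ and $d_0=\lambda/2$. The antennas are indexed by $n=(n_x,n_y)$ with $n_x\in\{-\frac{N_x-1}2,\dots,\frac{N_x-1}2\}$, $n_y\in\{-\frac{N_y-1}2,\dots,\frac{N_y-1}2\}$. Put $\alpha=\sin\theta\cos\phi$, $\beta=\sin\theta\sin\phi$. The far-field steering vector is $[\mathbf a(\theta,\phi)]_n=e^{\jmath\frac{2\pi}{\lambda}d_0(n_x\alpha+n_y\beta)}$. The near-field steering vector is $[\mathbf b(r,\theta,\phi)]_n=\frac1{\sqrt N}e^{-\jmath\frac{2\pi}{\lambda}(r_n-r)}$, where $r_n$ is either the exact range $$r_n=r\Big(1+\tfrac{(n_x^2+n_y^2)d_0^2}{r^2}-\tfrac{2d_0}{r}(n_x\alpha+n_y\beta)\Big)^{1/2}$$ or its Fresnel approximation $$r_n=r-n_xd_0\alpha-n_yd_0\beta+\tfrac{n_x^2d_0^2(1-\alpha^2)+n_y^2d_0^2(1-\beta^2)}{2r}-\tfrac{n_xn_yd_0^2\alpha\beta}{r};$$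 the result below holds in each of these two models. The parameter vector of interest is $$\boldsymbol\eta=(\theta_1,\dots,\theta_{K_1},\phi_1,\dots,\phi_{K_1},\theta_{K_1+1},\dots,\theta_K,\phi_{K_1+1},\dots,\phi_K,r_{K_1+1},\dots,r_K),$$ with $r_k>0$ (in the exact model no near-field target sits at an antenna, i.e. $r_{k,n}\ne0$, where $r_{k,n}$ is $r_n$ at the parameters of target $k$). Let $\mathbf A=[\mathbf a(\theta_k,\phi_k)]_{k\le K_1}$, $\mathbf B=[\mathbf b(r_k,\theta_k,\phi_k)]_{K_1<k\le K}$ and $\mathbf G=[\mathbf A,\mathbf B]\in\mathbb C^{N\times K}$, assumed to have linearly independent columns. The data are $L$ independent reconstructed snapshots $\mathbf G\mathbf s_\ell+\mathbf n_\ell$, each circularly symmetric complex Gaussian with mean $0$ and covariance $\mathbf R=\mathbf G\mathbf S\mathbf G^H+\sigma^2\mathbf I_N$, where the source covariance $\mathbf S$ is Hermitian positive definite (for uncorrelated sources the true value is diagonal) and $\sigma^2>0$. The nuisance parameters are $\sigma^2$ and the $K^2$ real and imaginary parts of the entries of the Hermitian matrix $\mathbf S$. Let $\mathbf J$ be the Fisher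 information matrix (expected products of scores) of $\boldsymbol\eta$ and the nuisance parameters together. The stochastic Cramér–Rao bound $\mathbf{CRB}(\boldsymbol\eta)$ is the $\boldsymbol\eta$-block of $\mathbf J^{-1}$. **Closed form.** Let $\Pi_{\mathbf G}^\perp=\mathbf I_N-\mathbf G(\mathbf G^H\mathbf G)^{-1}\mathbf G^H$ and $$\mathbf Q=\mathbf S\mathbf G^H\mathbf R^{-1}\mathbf G\mathbf S=\begin{bmatrix}\mathbf Q_1&\mathbf Q_2\\ \mathbf Q_3&\mathbf Q_4\end{bmatrix},\qquad \mathbf Q_1\in\mathbb C^{K_1\times K_1},\quad \mathbf Q_4\in\mathbb C^{K_2\times K_2},$$ $$\mathbf D_F=\Big[\sum_{k\le K_1}\tfrac{\partial\mathbf A}{\partial\theta_k},\ \sum_{k\le K_1}\tfrac{\partial\mathbf A}{\partial\phi_k}\Big],\qquad \mathbf D_N=\Big[\sum_{k>K_1}\tfrac{\partial\mathbf B}{\partial\theta_k},\ \sum_{k>K_1}\tfrac{\partial\mathbf B}{\partial\phi_k},\ \sum_{k>K_1}\tfrac{\partial\mathbf B}{\partial r_k}\Big],$$ and let $\mathbf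 J_{p\times q}$ be the $p\times q$ all-ones matrix. With $\odot$ the entrywise and $\otimes$ the Kronecker product, define $$\mathbf F_{FF}=\mathrm{Re}[(\mathbf D_F^H\Pi_{\mathbf G}^\perp\mathbf D_F)\odot(\mathbf J_{2\times2}\otimes\mathbf Q_1^T)],\qquad \mathbf F_{FN}=\mathrm{Re}[(\mathbf D_F^H\Pi_{\mathbf G}^\perp\mathbf D_N)\odot(\mathbf J_{2\times3}\otimes\mathbf Q_3^T)],$$ $$\mathbf F_{NF}=\mathrm{Re}[(\mathbf D_N^H\Pi_{\mathbf G}^\perp\mathbf D_F)\odot(\mathbf J_{3\times2}\otimes\mathbf Q_2^T)],\qquad \mathbf F_{NN}=\mathrm{Re}[(\mathbf D_N^H\Pi_{\mathbf G}^\perp\mathbf D_N)\odot(\mathbf J_{3\times3}\otimes\mathbf Q_4^T)],$$ $$\mathbf F=\frac{2L}{\sigma^2}\begin{bmatrix}\mathbf F_{FF}&\mathbf F_{FN}\\ \mathbf F_{NF}&\mathbf F_{NN}\end{bmatrix}.$$ **Theorem.** The Fisher information matrix $\mathbf J$ is well defined (the likelihood is a positive probability density, the scores exist, and their products are integrable),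 its nuisance block $\mathbf J_{\nu\nu}$ is nonsingular, and the Fisher information of $\boldsymbol\eta$ in the presence of the nuisance parameters is $\mathbf J_{\eta\eta}-\mathbf J_{\eta\nu}\mathbf J_{\nu\nu}^{-1}\mathbf J_{\nu\eta}=\mathbf F$. The matrix $\mathbf J$ is nonsingular if and only if $\mathbf F$ is, and then $$\mathbf{CRB}(\boldsymbol\eta)=\mathbf F^{-1}.$$ In particular, if all targets are far-field ($K_2=0$) and $\mathbf F_{FF}$ is nonsingular, then $\mathbf{CRB}(\boldsymbol\eta)=\big(\frac{2L}{\sigma^2}\mathbf F_{FF}\big)^{-1}=\frac{\sigma^2}{2L}\mathbf F_{FF}^{-1}$. If all targets are near-field ($K_1=0$) and $\mathbf F_{NN}$ is nonsingular, then $\mathbf{CRB}(\boldsymbol\eta)=\big(\frac{2L}{\sigma^2}\mathbf F_{NN}\big)^{-1}=\frac{\sigma^2}{2L}\mathbf F_{NN}^{-1}$. -/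

import Mathlib

open MeasureTheory
open scoped Matrix Kronecker ComplexOrder

noncomputable section

namespace MixedField

/-! ### Statistical notions -/

section Statistics

variable {P X : Type*} [DecidableEq P]

/-- The score: the partial derivative of the log-likelihood with respect to the parameter `i`. -/
def score (p : (P → ℝ) → X → ℝ) (ω : P → ℝ) (i : P) (x : X) : ℝ :=
  deriv (fun t : ℝ => Real.log (p (Function.update ω i t) x)) (ω i)

/-- The Fisher information matrix at `ω` of a family `p` of densities:
the expectation of the products of the scores. -/
def fisherInformation [MeasureSpace X] (p : (P → ℝ) → X → ℝ) (ω : P → ℝ) : Matrix P P ℝ :=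
  Matrix.of fun i j => ∫ x, score p ω i x * score p ω j x * p ω x

/-- The Fisher information matrix at `ω` is well defined: `p ω` is a probability density, the
scores exist, and the expectations of their products converge. -/
structure HasFisherInformation [MeasureSpace X] (p : (P → ℝ) → X → ℝ) (ω : P → ℝ) : Prop where
  pos : ∀ x, 0 < p ω x
  integrable : Integrable (p ω)
  integral_eq_one : ∫ x, p ω x = 1
  differentiable : ∀ i x,
    DifferentiableAt ℝ (fun t : ℝ => Real.log (p (Function.update ω i t) x)) (ω i)
  integrable_score : ∀ i j, Integrable fun x => score p ω i x * score p ω j x * p ω x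

end Statistics

/-- Information on the parameters of interest (first block) when the parameters of the second
block are unknown nuisance parameters. -/
def efficientInformation {E V : Type*} [Fintype V] [DecidableEq V]
    (J : Matrix (E ⊕ V) (E ⊕ V) ℝ) : Matrix E E ℝ :=
  J.toBlocks₁₁ - J.toBlocks₁₂ * J.toBlocks₂₂⁻¹ * J.toBlocks₂₁

/-- The Cramér-Rao bound matrix of the parameters of interest: their block in the inverse of the
Fisher information matrix of all the unknown parameters. -/
def cramerRaoBound {E V : Type*} [Fintype E] [DecidableEq E] [Fintype V] [DecidableEq V]
    (J : Matrix (E ⊕ V) (E ⊕ V) ℝ) : Matrix E E ℝ :=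
  (J⁻¹).toBlocks₁₁

/-- Density, with respect to Lebesgue measure on `ℂⁿ`, of the circularly symmetric complex
Gaussian law with mean `0` and covariance matrix `R`. -/
def cnDensity {n : Type*} [Fintype n] [DecidableEq n] (R : Matrix n n ℂ) (x : n → ℂ) : ℝ :=
  (Real.pi ^ Fintype.card n * R.det.re)⁻¹ * Real.exp (-(star x ⬝ᵥ (R⁻¹ *ᵥ x)).re)

/-! ### Index types -/

/-- Antennas of the planar array, the pair `(y, x)` in the order of `a_y ⊗ a_x`. -/
abbrev Ant (Nx Ny : ℕ) := Fin Ny × Fin Nx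

/-- Targets: far-field ones, then near-field ones. -/
abbrev Tgt (K₁ K₂ : ℕ) := Fin K₁ ⊕ Fin K₂

/-- Parameters of interest. Far field: `(0, k)` is `θ_k`, `(1, k)` is `φ_k`.
Near field: `(0, k)` is `θ_k`, `(1, k)` is `φ_k`, `(2, k)` is `r_k`. -/
abbrev EtaIdx (K₁ K₂ : ℕ) := (Fin 2 × Fin K₁) ⊕ (Fin 3 × Fin K₂)

/-- Nuisance parameters: the `K²` real coordinates of the source covariance matrix, and the noise
power. -/
abbrev NuisIdx (K₁ K₂ : ℕ) := (Tgt K₁ K₂ × Tgt K₁ K₂) ⊕ Unit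

/-- All the unknown real parameters. -/
abbrev ParIdx (K₁ K₂ : ℕ) := EtaIdx K₁ K₂ ⊕ NuisIdx K₁ K₂

/-! ### Array geometry and steering vectors -/

/-- Centred antenna coordinate: `-(m-1)/2, …, (m-1)/2`. -/
def centred (m : ℕ) (i : Fin m) : ℝ := (i : ℝ) - ((m : ℝ) - 1) / 2

/-- `α = sin θ cos φ`. -/
def alpha (θ φ : ℝ) : ℝ := Real.sin θ * Real.cos φ

/-- `β = sin θ sin φ`. -/
def beta (θ φ : ℝ) : ℝ := Real.sin θ * Real.sin φ

/-- Response of the `m` antennas on one axis, with half-wavelength spacing. -/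
def axisResponse (lam : ℝ) (m : ℕ) (γ : ℝ) (i : Fin m) : ℂ :=
  Complex.exp (Complex.I * ((2 * Real.pi / lam * (lam / 2) * centred m i * γ : ℝ) : ℂ))

/-- Far-field steering vector `a(θ, φ) = a_y(β) ⊗ a_x(α)`. -/
def farSteering (lam : ℝ) {Nx Ny : ℕ} (θ φ : ℝ) (n : Ant Nx Ny) : ℂ :=
  axisResponse lam Ny (beta θ φ) n.1 * axisResponse lam Nx (alpha θ φ) n.2

/-- The two forms of the near-field model: the exact spherical wavefront, and its
two-dimensional Fresnel approximation. -/
inductive NearModel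
  | spherical
  | fresnel

/-- Range from a target to the `n`-th antenna, exact or in the Fresnel approximation. -/
def antennaRange (lam : ℝ) {Nx Ny : ℕ} (mdl : NearModel) (r θ φ : ℝ) (n : Ant Nx Ny) : ℝ :=
  let d := lam / 2
  let nx := centred Nx n.2
  let ny := centred Ny n.1
  let a := alpha θ φ
  let b := beta θ φ
  match mdl with
  | .spherical =>
      r * √(1 + (nx ^ 2 + ny ^ 2) * d ^ 2 / r ^ 2 - 2 * d / r * (nx * a + ny * b))
  | .fresnel =>
      r - nx * d * a - ny * d * b
        + (nx ^ 2 * d ^ 2 * (1 - a ^ 2) + ny ^ 2 * d ^ 2 * (1 - b ^ 2)) / (2 * r)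
        - nx * ny * d ^ 2 * a * b / r

/-- Near-field steering vector `b(r, θ, φ)`. -/
def nearSteering (lam : ℝ) {Nx Ny : ℕ} (mdl : NearModel) (r θ φ : ℝ) (n : Ant Nx Ny) : ℂ :=
  ((1 / √((Nx * Ny : ℕ) : ℝ) : ℝ) : ℂ) *
    Complex.exp (-(Complex.I *
      ((2 * Real.pi * (antennaRange lam mdl r θ φ n - r) / lam : ℝ) : ℂ)))

section Model

variable (Nx Ny : ℕ) {K₁ K₂ : ℕ} (lam : ℝ) (mdl : NearModel)

/-- Far-field array steering matrix `A`. -/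
def farASM (η : EtaIdx K₁ K₂ → ℝ) : Matrix (Ant Nx Ny) (Fin K₁) ℂ :=
  Matrix.of fun n k => farSteering lam (η (.inl (0, k))) (η (.inl (1, k))) n

/-- Near-field array steering matrix `B`. -/
def nearASM (η : EtaIdx K₁ K₂ → ℝ) : Matrix (Ant Nx Ny) (Fin K₂) ℂ :=
  Matrix.of fun n k =>
    nearSteering lam mdl (η (.inr (2, k))) (η (.inr (0, k))) (η (.inr (1, k))) n

/-- Array steering matrix `G = [A, B]`. -/
def asm (η : EtaIdx K₁ K₂ → ℝ) : Matrix (Ant Nx Ny) (Tgt K₁ K₂) ℂ :=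
  Matrix.fromCols (farASM Nx Ny lam η) (nearASM Nx Ny lam mdl η)

/-- Covariance matrix `R = G S Gᴴ + σ² I` of a reconstructed snapshot. -/
def snapshotCov (η : EtaIdx K₁ K₂ → ℝ) (S : Matrix (Tgt K₁ K₂) (Tgt K₁ K₂) ℂ) (σsq : ℝ) :
    Matrix (Ant Nx Ny) (Ant Nx Ny) ℂ :=
  asm Nx Ny lam mdl η * S * (asm Nx Ny lam mdl η)ᴴ + (σsq : ℂ) • 1

end Model

/-! ### Parametrisation and likelihood -/

section Likelihood

variable {K₁ K₂ : ℕ}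

/-- Hermitian matrix with given real coordinates: the diagonal and the real parts of the entries
above it are stored in place, the imaginary parts of the latter in the transposed places. -/
def hermOfCoord (c : Tgt K₁ K₂ × Tgt K₁ K₂ → ℝ) : Matrix (Tgt K₁ K₂) (Tgt K₁ K₂) ℂ :=
  Matrix.of fun i j =>
    if i = j then (c (i, i) : ℂ)
    else if toLex i < toLex j then ⟨c (i, j), c (j, i)⟩
    else ⟨c (j, i), -c (i, j)⟩

/-- Real coordinates of a Hermitian matrix. -/
def hermCoord (S : Matrix (Tgt K₁ K₂) (Tgt K₁ K₂) ℂ) (ij : Tgt K₁ K₂ × Tgt K₁ K₂) : ℝ :=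
  if toLex ij.2 < toLex ij.1 then (S ij.2 ij.1).im else (S ij.1 ij.2).re

theorem hermOfCoord_hermCoord (S : Matrix (Tgt K₁ K₂) (Tgt K₁ K₂) ℂ) (hS : S.IsHermitian) :
    hermOfCoord (hermCoord S) = S := by
  ext i j
  have hij : S i j = star (S j i) := (hS.apply i j).symm
  by_cases h : i = j
  · subst h
    have him := congrArg Complex.im hij
    simp only [RCLike.star_def, Complex.conj_im] at him
    apply Complex.ext
    · simp [hermOfCoord, hermCoord]
    · simp only [hermOfCoord, Matrix.of_apply, if_true, Complex.ofReal_im]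
      linarith
  · by_cases hlt : toLex i < toLex j
    · simp only [hermOfCoord, hermCoord, Matrix.of_apply, if_neg h, if_pos hlt, if_neg hlt.not_gt,
        Complex.eta]
    · have hgt : toLex j < toLex i :=
        lt_of_le_of_ne (not_lt.mp hlt) fun e => h (toLex.injective e).symm
      rw [hij]
      simp only [hermOfCoord, hermCoord, Matrix.of_apply, if_neg h, if_neg hlt, if_pos hgt]
      apply Complex.ext <;> simp

/-- The vector of all the unknown parameters. -/
def parVec (η : EtaIdx K₁ K₂ → ℝ) (S : Matrix (Tgt K₁ K₂) (Tgt K₁ K₂) ℂ) (σsq : ℝ) :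
    ParIdx K₁ K₂ → ℝ :=
  Sum.elim η (Sum.elim (hermCoord S) fun _ => σsq)

/-- Likelihood of `L` independent reconstructed snapshots, each of them circular complex Gaussian
with mean `0` and covariance `G S Gᴴ + σ² I`, as a function of all the unknown parameters. -/
def likelihood (Nx Ny L : ℕ) (lam : ℝ) (mdl : NearModel) (ω : ParIdx K₁ K₂ → ℝ)
    (x : Fin L → Ant Nx Ny → ℂ) : ℝ :=
  ∏ l, cnDensity
    (snapshotCov Nx Ny lam mdl (fun i => ω (.inl i)) (hermOfCoord fun q => ω (.inr (.inl q)))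
      (ω (.inr (.inr ())))) (x l)

/-- The Fisher information matrix of all the unknown parameters. -/
def fullFIM (Nx Ny L : ℕ) (lam : ℝ) (mdl : NearModel) (η : EtaIdx K₁ K₂ → ℝ)
    (S : Matrix (Tgt K₁ K₂) (Tgt K₁ K₂) ℂ) (σsq : ℝ) :
    Matrix (ParIdx K₁ K₂) (ParIdx K₁ K₂) ℝ :=
  fisherInformation (likelihood Nx Ny L lam mdl) (parVec η S σsq)

/-- The stochastic Cramér-Rao bound matrix of the angles and ranges. -/
def stochasticCRB (Nx Ny L : ℕ) (lam : ℝ) (mdl : NearModel) (η : EtaIdx K₁ K₂ → ℝ)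
    (S : Matrix (Tgt K₁ K₂) (Tgt K₁ K₂) ℂ) (σsq : ℝ) :
    Matrix (EtaIdx K₁ K₂) (EtaIdx K₁ K₂) ℝ :=
  cramerRaoBound (fullFIM Nx Ny L lam mdl η S σsq)

end Likelihood

/-! ### The closed form -/

section ClosedForm

/-- `I - G (Gᴴ G)⁻¹ Gᴴ`. -/
def projPerp {m k : Type*} [Fintype m] [DecidableEq m] [Fintype k] [DecidableEq k]
    (G : Matrix m k ℂ) : Matrix m m ℂ :=
  1 - G * (Gᴴ * G)⁻¹ * Gᴴ

/-- The all-ones matrix. -/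
def onesMat (p q : ℕ) : Matrix (Fin p) (Fin q) ℂ := Matrix.of fun _ _ => 1

/-- One block `Re[(Dᴴ Π D') ⊙ (J ⊗ Qᵀ)]`. -/
def fimBlock {m : Type*} [Fintype m] {p q k k' : ℕ}
    (D : Matrix m (Fin p × Fin k) ℂ) (Pi : Matrix m m ℂ) (D' : Matrix m (Fin q × Fin k') ℂ)
    (Q : Matrix (Fin k') (Fin k) ℂ) : Matrix (Fin p × Fin k) (Fin q × Fin k') ℝ :=
  ((Dᴴ * Pi * D') ⊙ (onesMat p q ⊗ₖ Qᵀ)).map Complex.re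

variable (Nx Ny : ℕ) {K₁ K₂ : ℕ} (lam : ℝ) (mdl : NearModel) (η : EtaIdx K₁ K₂ → ℝ)

/-- `D_F = [∑ₖ ∂A/∂θₖ, ∑ₖ ∂A/∂φₖ]`. -/
def farDeriv : Matrix (Ant Nx Ny) (Fin 2 × Fin K₁) ℂ :=
  Matrix.of fun n pk => ∑ k : Fin K₁,
    deriv (fun t : ℝ => farASM Nx Ny lam (Function.update η (.inl (pk.1, k)) t) n pk.2)
      (η (.inl (pk.1, k)))

/-- `D_N = [∑ₖ ∂B/∂θₖ, ∑ₖ ∂B/∂φₖ, ∑ₖ ∂B/∂rₖ]`. -/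
def nearDeriv : Matrix (Ant Nx Ny) (Fin 3 × Fin K₂) ℂ :=
  Matrix.of fun n pk => ∑ k : Fin K₂,
    deriv (fun t : ℝ => nearASM Nx Ny lam mdl (Function.update η (.inr (pk.1, k)) t) n pk.2)
      (η (.inr (pk.1, k)))

variable (S : Matrix (Tgt K₁ K₂) (Tgt K₁ K₂) ℂ) (σsq : ℝ)

/-- `Q = S Gᴴ R⁻¹ G S`. -/
def qMat : Matrix (Tgt K₁ K₂) (Tgt K₁ K₂) ℂ :=
  S * (asm Nx Ny lam mdl η)ᴴ * (snapshotCov Nx Ny lam mdl η S σsq)⁻¹ * asm Nx Ny lam mdl η * S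

/-- `F_FF`, with `Q₁`. -/
def fimFF : Matrix (Fin 2 × Fin K₁) (Fin 2 × Fin K₁) ℝ :=
  fimBlock (farDeriv Nx Ny lam η) (projPerp (asm Nx Ny lam mdl η)) (farDeriv Nx Ny lam η)
    (qMat Nx Ny lam mdl η S σsq).toBlocks₁₁

/-- `F_FN`, with `Q₃`. -/
def fimFN : Matrix (Fin 2 × Fin K₁) (Fin 3 × Fin K₂) ℝ :=
  fimBlock (farDeriv Nx Ny lam η) (projPerp (asm Nx Ny lam mdl η)) (nearDeriv Nx Ny lam mdl η)
    (qMat Nx Ny lam mdl η S σsq).toBlocks₂₁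

/-- `F_NF`, with `Q₂`. -/
def fimNF : Matrix (Fin 3 × Fin K₂) (Fin 2 × Fin K₁) ℝ :=
  fimBlock (nearDeriv Nx Ny lam mdl η) (projPerp (asm Nx Ny lam mdl η)) (farDeriv Nx Ny lam η)
    (qMat Nx Ny lam mdl η S σsq).toBlocks₁₂

/-- `F_NN`, with `Q₄`. -/
def fimNN : Matrix (Fin 3 × Fin K₂) (Fin 3 × Fin K₂) ℝ :=
  fimBlock (nearDeriv Nx Ny lam mdl η) (projPerp (asm Nx Ny lam mdl η))
    (nearDeriv Nx Ny lam mdl η) (qMat Nx Ny lam mdl η S σsq).toBlocks₂₂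

/-- `F = (2L/σ²) [F_FF, F_FN; F_NF, F_NN]`. -/
def closedFIM (L : ℕ) : Matrix (EtaIdx K₁ K₂) (EtaIdx K₁ K₂) ℝ :=
  (2 * (L : ℝ) / σsq) • Matrix.fromBlocks
    (fimFF Nx Ny lam mdl η S σsq) (fimFN Nx Ny lam mdl η S σsq)
    (fimNF Nx Ny lam mdl η S σsq) (fimNN Nx Ny lam mdl η S σsq)

end ClosedForm

end MixedField

end

/-! Everything takes place in the space of Hermitian matrices with the inner product `covInner R A
B` = Re tr(R⁻¹ A R⁻¹ B). For `L` Gaussian snapshots whose covariance depends on real parameters, the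
Fisher information is `L` times the Gram matrix of the partial derivatives of the covariance
(`fisherInformation_cn`). To see this, diagonalize R and a direction A simultaneously by congruence:
the score along A becomes a sum of independent variables dᵢ(|zᵢ|² - 1), so its variance is ∑ dᵢ² =
`covInner R A A`. Polarization gives the mixed moments.

For a Gram matrix, eliminating nuisance parameters means projecting the directions of interest onto
the orthogonal complement of the nuisance directions (`efficientInformation_covInner`). Here the
nuisance directions span the matrices G H Gᴴ + c I with H Hermitian and c real. Let Π be the
projector onto the complement of the column space of G. The direction D S Gᴴ + G S Dᴴ, produced by
moving G along D, splits as (Π D S Gᴴ + G S Dᴴ Π) + G H Gᴴ (`orthDir_add_nuisancePart`). The first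
part is orthogonal to every nuisance direction, because R⁻¹ Π = σ⁻² Π and Gᴴ Π = 0
(`covInner_orthDir_eq_zero`). The same two identities evaluate the inner products of such parts as
(2/σ²) Re tr(D'ᴴ Π D Q) (`covInner_orthDir`).

Each parameter moves only the column of its own target, so this trace is one entry of a Hadamard
product (`trace_asmDeriv`), which is the closed form. The nuisance block is nonsingular because its
directions are linearly independent, which uses K < N. The claims about the inverse of J are then
Schur complement identities. -/

noncomputable section

namespace MixedField

/-! ### Moments of independent sums, and linear change of variables -/

/-- `f` is centred with variance `v` under the probability density `p`. -/
structure CentredMoments {X : Type*} [MeasureSpace X] (p f : X → ℝ) (v : ℝ) : Prop where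
  integrable : Integrable p
  integral_eq_one : ∫ x, p x = 1
  integrable_one : Integrable fun x => f x * p x
  integral_one : ∫ x, f x * p x = 0
  integrable_two : Integrable fun x => f x ^ 2 * p x
  integral_two : ∫ x, f x ^ 2 * p x = v

namespace CentredMoments

variable {X : Type*} [MeasureSpace X]

theorem const_mul {p f : X → ℝ} {v : ℝ} (h : CentredMoments p f v) (c : ℝ) :
    CentredMoments p (fun x => c * f x) (c ^ 2 * v) where
  integrable := h.integrable
  integral_eq_one := h.integral_eq_one
  integrable_one := by simpa only [mul_assoc] using h.integrable_one.const_mul c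
  integral_one := by simp only [mul_assoc, integral_const_mul, h.integral_one, mul_zero]
  integrable_two := by simpa only [mul_assoc, mul_pow] using h.integrable_two.const_mul (c ^ 2)
  integral_two := by simp only [mul_assoc, mul_pow, integral_const_mul, h.integral_two]

/-- Under a product density, sums of independent centred functions have additive variance. -/
theorem sum {ι : Type*} [Fintype ι] [SigmaFinite (volume : Measure X)] {p : X → ℝ}
    {f : ι → X → ℝ} {v : ι → ℝ} (hp : Integrable p) (hp1 : ∫ x, p x = 1)
    (h : ∀ i, CentredMoments p (f i) (v i)) :
    CentredMoments (fun x : ι → X => ∏ i, p (x i)) (fun x => ∑ i, f i (x i)) (∑ i, v i) := by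
  classical
  -- Padding with unit factors makes each term a product of functions of single coordinates, to
  -- which Fubini applies.
  have e1 : ∀ i, (fun x : ι → X => f i (x i) * ∏ k, p (x k)) =
      fun x => ∏ k, ((if k = i then f i (x k) else 1) * p (x k)) := by
    intro i
    ext x
    rw [Finset.prod_mul_distrib, Finset.prod_ite_eq' Finset.univ i fun k => f i (x k)]
    simp
  have i1 : ∀ i k, Integrable fun y => (if k = i then f i y else 1) * p y := by
    intro i k
    split_ifs
    · exact (h i).integrable_one
    · simpa using hp
  have e2 : ∀ i j, (fun x : ι → X => f i (x i) * f j (x j) * ∏ k, p (x k)) =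
      fun x => ∏ k, ((if k = i then f i (x k) else 1) * (if k = j then f j (x k) else 1)
        * p (x k)) := by
    intro i j
    ext x
    rw [Finset.prod_mul_distrib, Finset.prod_mul_distrib,
      Finset.prod_ite_eq' Finset.univ i fun k => f i (x k),
      Finset.prod_ite_eq' Finset.univ j fun k => f j (x k)]
    simp
  have i2 : ∀ i j k, Integrable fun y =>
      (if k = i then f i y else 1) * (if k = j then f j y else 1) * p y := by
    intro i j k
    by_cases hi : k = i
    · by_cases hj : k = j
      · subst hi
        subst hj
        simpa [pow_two] using (h k).integrable_two
      · subst hi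
        simpa [hj] using (h k).integrable_one
    · by_cases hj : k = j
      · subst hj
        simpa [hi] using (h k).integrable_one
      · simpa [hi, hj] using hp
  have j1 : ∀ i, Integrable fun x : ι → X => f i (x i) * ∏ k, p (x k) := by
    intro i
    rw [e1]
    exact Integrable.fintype_prod (i1 i)
  have j2 : ∀ i j, Integrable fun x : ι → X => f i (x i) * f j (x j) * ∏ k, p (x k) := by
    intro i j
    rw [e2]
    exact Integrable.fintype_prod (i2 i j)
  have k2 : ∀ i j, ∫ x : ι → X, f i (x i) * f j (x j) * ∏ k, p (x k) =
      if i = j then v i else 0 := by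
    intro i j
    rw [e2, integral_fintype_prod_volume_eq_prod fun k y =>
      (if k = i then f i y else 1) * (if k = j then f j y else 1) * p y]
    split_ifs with hij
    · subst hij
      rw [Finset.prod_eq_single i]
      · simpa [pow_two] using (h i).integral_two
      · intro k _ hk
        simpa [hk] using hp1
      · simp
    -- For `i ≠ j` the factor at `i` is `f i` alone, which is centred.
    · refine Finset.prod_eq_zero (Finset.mem_univ i) ?_
      simpa [hij] using (h i).integral_one
  have sq : ∀ x : ι → X, (∑ i, f i (x i)) ^ 2 * ∏ k, p (x k) =
      ∑ i, ∑ j, f i (x i) * f j (x j) * ∏ k, p (x k) := by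
    intro x
    rw [pow_two, Finset.sum_mul_sum, Finset.sum_mul]
    simp only [Finset.sum_mul]
  refine ⟨Integrable.fintype_prod fun _ => hp, ?_, ?_, ?_, ?_, ?_⟩
  · rw [integral_fintype_prod_volume_eq_prod fun _ => p]
    simp [hp1]
  · simp only [Finset.sum_mul]
    exact integrable_finsetSum _ fun i _ => j1 i
  · simp only [Finset.sum_mul]
    rw [integral_finsetSum _ fun i _ => j1 i]
    refine Finset.sum_eq_zero fun i _ => ?_
    rw [e1, integral_fintype_prod_volume_eq_prod fun k y => (if k = i then f i y else 1) * p y]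
    refine Finset.prod_eq_zero (Finset.mem_univ i) ?_
    simpa using (h i).integral_one
  · simp only [sq]
    exact integrable_finsetSum _ fun i _ => integrable_finsetSum _ fun j _ => j2 i j
  · simp only [sq]
    rw [integral_finsetSum _ fun i _ => integrable_finsetSum _ fun j _ => j2 i j]
    refine Finset.sum_congr rfl fun i _ => ?_
    rw [integral_finsetSum _ fun j _ => j2 i j]
    simp [k2]

/-- Linear change of variables. -/
theorem of_comp {n : Type*} [Fintype n] {p f : (n → ℂ) → ℝ} {v : ℝ}
    (T : (n → ℂ) →ₗ[ℝ] (n → ℂ)) (hT : LinearMap.det T ≠ 0)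
    (h : CentredMoments (fun z => |LinearMap.det T| * p (T z)) (fun z => f (T z)) v) :
    CentredMoments p f v := by
  have hmap := Measure.map_linearMap_addHaar_eq_smul_addHaar (volume : Measure (n → ℂ)) hT
  have hemb : MeasurableEmbedding T :=
    (LinearEquiv.ofIsUnitDet (f := T) (v := Module.finBasis ℝ _) (v' := Module.finBasis ℝ _)
      (by simpa using hT)).toContinuousLinearEquiv.toHomeomorph.measurableEmbedding
  have hd : 0 < |LinearMap.det T| := abs_pos.mpr hT
  have hint : ∀ g : (n → ℂ) → ℝ, Integrable (fun z => |LinearMap.det T| * g (T z)) →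
      Integrable g := by
    intro g hg
    have h1 : Integrable (g ∘ T) := by
      simpa [hd.ne', Function.comp_def] using hg.const_mul |LinearMap.det T|⁻¹
    rw [← hemb.integrable_map_iff, hmap] at h1
    rwa [integrable_smul_measure (by simpa using hT) (by simp)] at h1
  have hval : ∀ g : (n → ℂ) → ℝ, ∫ z, |LinearMap.det T| * g (T z) = ∫ x, g x := by
    intro g
    rw [integral_const_mul, ← hemb.integral_map, hmap, integral_smul_measure,
      ENNReal.toReal_ofReal (abs_nonneg _), abs_inv, smul_eq_mul, ← mul_assoc,
      mul_inv_cancel₀ hd.ne', one_mul]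
  have r1 : ∀ z, f (T z) * (|LinearMap.det T| * p (T z)) =
      |LinearMap.det T| * (f (T z) * p (T z)) := fun z => by ring
  have r2 : ∀ z, f (T z) ^ 2 * (|LinearMap.det T| * p (T z)) =
      |LinearMap.det T| * (f (T z) ^ 2 * p (T z)) := fun z => by ring
  obtain ⟨h1, h2, h3, h4, h5, h6⟩ := h
  simp only [r1, r2] at h3 h4 h5 h6
  exact ⟨hint _ h1, (hval _).symm.trans h2, hint (fun x => f x * p x) h3,
    (hval fun x => f x * p x).symm.trans h4, hint (fun x => f x ^ 2 * p x) h5,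
    (hval fun x => f x ^ 2 * p x).symm.trans h6⟩

end CentredMoments

/-! ### Moments of the standard complex Gaussian -/

theorem integral_normSq_pow_mul_exp (m : ℕ) :
    ∫ z : ℂ, Complex.normSq z ^ m * Real.exp (-Complex.normSq z) = Real.pi * m.factorial := by
  have h := Complex.integral_rpow_mul_exp_neg_rpow (p := 2) (q := (2 * m : ℕ)) one_le_two
    (by have : (0 : ℝ) ≤ (2 * m : ℕ) := Nat.cast_nonneg _
        linarith)
  have e : ((2 * m : ℕ) + 2 : ℝ) / 2 = m + 1 := by
    push_cast
    ring
  rw [e, Real.Gamma_nat_eq_factorial] at h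
  rw [show Real.pi * (m.factorial : ℝ) = 2 * Real.pi / 2 * m.factorial by ring, ← h]
  congr 1
  ext z
  rw [Real.rpow_natCast, pow_mul, ← Complex.normSq_eq_norm_sq, Real.rpow_two,
    ← Complex.normSq_eq_norm_sq]

/-- A nonintegrable function has Bochner integral `0`, whereas this integral is positive. -/
theorem integrable_normSq_pow_mul_exp (m : ℕ) :
    Integrable fun z : ℂ => Complex.normSq z ^ m * Real.exp (-Complex.normSq z) := by
  by_contra h
  have h1 := integral_normSq_pow_mul_exp m
  rw [integral_undef h] at h1
  have : (0 : ℝ) < Real.pi * m.factorial := by positivity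
  linarith

/-- The centred squared modulus of a standard complex Gaussian variable. -/
theorem centredMoments_normSq :
    CentredMoments (fun z : ℂ => Real.pi⁻¹ * Real.exp (-Complex.normSq z))
      (fun z => Complex.normSq z - 1) 1 := by
  have I := integrable_normSq_pow_mul_exp
  have V := integral_normSq_pow_mul_exp
  have e1 : (fun z : ℂ => (Complex.normSq z - 1) * (Real.pi⁻¹ * Real.exp (-Complex.normSq z))) =
      fun z => Real.pi⁻¹ * (Complex.normSq z ^ 1 * Real.exp (-Complex.normSq z)
        - Complex.normSq z ^ 0 * Real.exp (-Complex.normSq z)) := by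
    ext z
    ring
  have e2 : (fun z : ℂ => (Complex.normSq z - 1) ^ 2 *
        (Real.pi⁻¹ * Real.exp (-Complex.normSq z))) =
      fun z => Real.pi⁻¹ * (Complex.normSq z ^ 2 * Real.exp (-Complex.normSq z)
        - 2 * (Complex.normSq z ^ 1 * Real.exp (-Complex.normSq z))
        + Complex.normSq z ^ 0 * Real.exp (-Complex.normSq z)) := by
    ext z
    ring
  refine ⟨?_, ?_, ?_, ?_, ?_, ?_⟩
  · simpa using (I 0).const_mul Real.pi⁻¹
  · have := V 0
    simp only [pow_zero, one_mul] at this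
    rw [integral_const_mul, this]
    simp [Real.pi_ne_zero]
  · rw [e1]
    exact ((I 1).sub (I 0)).const_mul _
  · rw [e1, integral_const_mul, integral_sub (I 1) (I 0), V, V]
    simp
  · rw [e2]
    exact (((I 2).sub ((I 1).const_mul 2)).add (I 0)).const_mul _
  -- The variance is 2! - 2 · 1! + 0! = 1.
  · have h21 : Integrable fun z : ℂ => Complex.normSq z ^ 2 * Real.exp (-Complex.normSq z)
        - 2 * (Complex.normSq z ^ 1 * Real.exp (-Complex.normSq z)) :=
      (I 2).sub ((I 1).const_mul 2)
    rw [e2, integral_const_mul, integral_add h21 (I 0),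
      integral_sub (I 2) ((I 1).const_mul 2), integral_const_mul, V, V, V]
    have := Real.pi_ne_zero
    norm_num [Nat.factorial]
    field_simp
    norm_num

/-! ### Variance of a Gaussian score -/

section Gaussian

variable {n : Type*} [Fintype n] [DecidableEq n]

/-- The score of `cnDensity R` in the direction `A`. -/
def cnScore (R A : Matrix n n ℂ) (x : n → ℂ) : ℝ :=
  (star x ⬝ᵥ ((R⁻¹ * A * R⁻¹) *ᵥ x)).re - (R⁻¹ * A).trace.re

/-- The Fisher inner product of two directions at the covariance matrix `R`. -/
def covInner (R A B : Matrix n n ℂ) : ℝ := (R⁻¹ * A * R⁻¹ * B).trace.re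

theorem exists_unitary_diagonalization {A : Matrix n n ℂ} (hA : A.IsHermitian) :
    ∃ (U : Matrix n n ℂ) (d : n → ℝ), U * Uᴴ = 1 ∧
      A = U * Matrix.diagonal (fun i => (d i : ℂ)) * Uᴴ := by
  have h := hA.spectral_theorem
  rw [Unitary.conjStarAlgAut_apply] at h
  exact ⟨hA.eigenvectorUnitary, hA.eigenvalues, Unitary.coe_mul_star_self _, h⟩

open scoped MatrixOrder in
/-- Simultaneous diagonalization of a positive definite and a Hermitian matrix by congruence. -/
theorem exists_simultaneous_diagonalization {R A : Matrix n n ℂ} (hR : R.PosDef)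
    (hA : A.IsHermitian) :
    ∃ (C : Matrix n n ℂ) (d : n → ℝ), IsUnit C.det ∧ R = C * Cᴴ ∧
      A = C * Matrix.diagonal (fun i => (d i : ℂ)) * Cᴴ := by
  obtain ⟨B, hB⟩ := CStarAlgebra.nonneg_iff_eq_star_mul_self.mp hR.posSemidef.nonneg
  rw [Matrix.star_eq_conjTranspose] at hB
  have hBu : IsUnit B.det := by
    have := (Matrix.isUnit_iff_isUnit_det _).mp hR.isUnit
    rw [hB, Matrix.det_mul] at this
    exact isUnit_of_mul_isUnit_right this
  have hBu' : IsUnit Bᴴ.det := by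
    rw [Matrix.det_conjTranspose]
    exact hBu.star
  have hM : ((Bᴴ)⁻¹ * A * B⁻¹).IsHermitian := by
    rw [Matrix.IsHermitian, Matrix.conjTranspose_mul, Matrix.conjTranspose_mul, hA.eq,
      Matrix.conjTranspose_nonsing_inv, Matrix.conjTranspose_nonsing_inv,
      Matrix.conjTranspose_conjTranspose, mul_assoc]
  obtain ⟨U, d, hUU, hspec⟩ := exists_unitary_diagonalization hM
  -- With R = Bᴴ B, the unitary `U` diagonalizes B⁻ᴴ A B⁻¹. Conjugating back by Bᴴ restores A, and U
  -- Uᴴ = 1 leaves R unaffected.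
  refine ⟨Bᴴ * U, d, ?_, ?_, ?_⟩
  · rw [Matrix.det_mul]
    exact hBu'.mul (Matrix.isUnit_det_of_right_inverse hUU)
  · rw [Matrix.conjTranspose_mul, Matrix.conjTranspose_conjTranspose, mul_assoc, ← mul_assoc U,
      hUU, one_mul, hB]
  · calc A = Bᴴ * ((Bᴴ)⁻¹ * A * B⁻¹) * B := by
          simp only [mul_assoc]
          rw [Matrix.nonsing_inv_mul _ hBu, mul_one, ← mul_assoc,
            Matrix.mul_nonsing_inv _ hBu', one_mul]
      _ = _ := by
          rw [hspec]
          simp only [Matrix.conjTranspose_mul, Matrix.conjTranspose_conjTranspose, mul_assoc]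

/-- Write R = C Cᴴ and A = C diag(d) Cᴴ. In the variable z = C⁻¹ x the density is a product of
standard ones and the score is ∑ dᵢ(|zᵢ|² - 1), so variances add up to ∑ dᵢ². -/
theorem centredMoments_cnScore {R A : Matrix n n ℂ} (hR : R.PosDef) (hA : A.IsHermitian) :
    CentredMoments (cnDensity R) (cnScore R A) (covInner R A A) := by
  obtain ⟨C, d, hC, rfl, rfl⟩ := exists_simultaneous_diagonalization hR hA
  have hC' : IsUnit Cᴴ.det := by
    rw [Matrix.det_conjTranspose]
    exact hC.star
  have inv : (C * Cᴴ)⁻¹ = (Cᴴ)⁻¹ * C⁻¹ := Matrix.mul_inv_rev _ _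
  have c1 : C⁻¹ * C = 1 := Matrix.nonsing_inv_mul _ hC
  have c2 : Cᴴ * (Cᴴ)⁻¹ = 1 := Matrix.mul_nonsing_inv _ hC'
  have c1' : ∀ X : Matrix n n ℂ, C⁻¹ * (C * X) = X := fun X => by rw [← mul_assoc, c1, one_mul]
  have c2' : ∀ X : Matrix n n ℂ, Cᴴ * ((Cᴴ)⁻¹ * X) = X := fun X => by
    rw [← mul_assoc, c2, one_mul]
  set T : (n → ℂ) →ₗ[ℝ] (n → ℂ) := (Matrix.toLin' C).restrictScalars ℝ with hT
  -- The real determinant of a complex-linear map is the squared modulus of its complex determinant.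
  -- It equals det R, so the Jacobian cancels the normalization of the density.
  have hdet : LinearMap.det T = Complex.normSq C.det := by
    rw [hT, LinearMap.det_restrictScalars, LinearMap.det_toLin', Algebra.norm_complex_apply]
  have hpos : 0 < Complex.normSq C.det := Complex.normSq_pos.mpr hC.ne_zero
  have quad : ∀ (D : Matrix n n ℂ) (z : n → ℂ),
      star (C *ᵥ z) ⬝ᵥ (((Cᴴ)⁻¹ * (D * C⁻¹)) *ᵥ (C *ᵥ z)) = star z ⬝ᵥ (D *ᵥ z) := by
    intro D z
    rw [Matrix.star_mulVec, ← Matrix.dotProduct_mulVec, Matrix.mulVec_mulVec,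
      Matrix.mulVec_mulVec]
    simp only [mul_assoc, c1, c2', mul_one]
  have hdetR : (C * Cᴴ).det.re = Complex.normSq C.det := by
    rw [Matrix.det_mul, Matrix.det_conjTranspose, RCLike.star_def, Complex.mul_conj,
      Complex.ofReal_re]
  have hden : (fun z => |LinearMap.det T| * cnDensity (C * Cᴴ) (T z)) =
      fun z => ∏ i, (Real.pi⁻¹ * Real.exp (-Complex.normSq (z i))) := by
    ext z
    have hq := quad 1 z
    rw [one_mul, Matrix.one_mulVec] at hq
    have hz : (star z ⬝ᵥ z).re = ∑ i, Complex.normSq (z i) := by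
      simp only [dotProduct, Pi.star_apply, RCLike.star_def, Complex.re_sum]
      refine Finset.sum_congr rfl fun i _ => ?_
      rw [← Complex.normSq_eq_conj_mul_self, Complex.ofReal_re]
    rw [hdet, abs_of_pos hpos, cnDensity, hdetR, inv]
    change _ * (_ * Real.exp (-(star (C *ᵥ z) ⬝ᵥ (((Cᴴ)⁻¹ * C⁻¹) *ᵥ (C *ᵥ z))).re)) = _
    rw [hq, hz, Finset.prod_mul_distrib, Finset.prod_const, ← Real.exp_sum,
      Finset.sum_neg_distrib, Finset.card_univ]
    rw [inv_pow]
    field_simp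
  have hsc : (fun z => cnScore (C * Cᴴ) (C * Matrix.diagonal (fun i => (d i : ℂ)) * Cᴴ) (T z)) =
      fun z => ∑ i, d i * (Complex.normSq (z i) - 1) := by
    ext z
    have hM : (C * Cᴴ)⁻¹ * (C * Matrix.diagonal (fun i => (d i : ℂ)) * Cᴴ) * (C * Cᴴ)⁻¹ =
        (Cᴴ)⁻¹ * (Matrix.diagonal (fun i => (d i : ℂ)) * C⁻¹) := by
      simp only [inv, mul_assoc, c1', c2']
    have htr : ((C * Cᴴ)⁻¹ * (C * Matrix.diagonal (fun i => (d i : ℂ)) * Cᴴ)).trace =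
        ∑ i, (d i : ℂ) := by
      rw [inv, Matrix.trace_mul_comm]
      simp only [mul_assoc, c2']
      rw [Matrix.trace_mul_comm, mul_assoc, c1, mul_one, Matrix.trace_diagonal]
    rw [cnScore, hM, htr]
    change (star (C *ᵥ z) ⬝ᵥ (_ *ᵥ (C *ᵥ z))).re - _ = _
    rw [quad]
    simp only [dotProduct, Pi.star_apply, RCLike.star_def, Complex.re_sum, Complex.ofReal_re,
      Matrix.mulVec_diagonal]
    rw [← Finset.sum_sub_distrib]
    refine Finset.sum_congr rfl fun i _ => ?_
    rw [mul_left_comm, ← Complex.normSq_eq_conj_mul_self, ← Complex.ofReal_mul, Complex.ofReal_re]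
    ring
  have hvar : covInner (C * Cᴴ) (C * Matrix.diagonal (fun i => (d i : ℂ)) * Cᴴ)
      (C * Matrix.diagonal (fun i => (d i : ℂ)) * Cᴴ) = ∑ i, d i ^ 2 * 1 := by
    rw [covInner, inv]
    simp only [mul_assoc, c1', c2']
    rw [Matrix.trace_mul_comm]
    simp only [mul_assoc, c2, mul_one, Matrix.diagonal_mul_diagonal, Matrix.trace_diagonal,
      Complex.re_sum, ← Complex.ofReal_mul, Complex.ofReal_re, pow_two]
  refine CentredMoments.of_comp T (by rw [hdet]; exact hpos.ne') ?_
  rw [hden, hsc, hvar]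
  have h1 := centredMoments_normSq
  exact CentredMoments.sum (f := fun i z => d i * (Complex.normSq z - 1)) h1.integrable
    h1.integral_eq_one fun i => h1.const_mul (d i)

end Gaussian

/-! ### Derivatives of determinant, inverse and log-density -/

section Derivatives

variable {n : Type*} [Fintype n] [DecidableEq n]

/-- A permutation other than the identity moves at least two points, so each term of its
differentiated product keeps an off-diagonal entry of the identity matrix and vanishes. -/
theorem hasDerivAt_det_of_eq_one {M : ℝ → Matrix n n ℂ} {M' : Matrix n n ℂ} {t : ℝ}
    (h1 : M t = 1) (h : ∀ i j, HasDerivAt (fun s => M s i j) (M' i j) t) :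
    HasDerivAt (fun s => (M s).det) M'.trace t := by
  simp only [Matrix.det_apply]
  have hd := HasDerivAt.fun_sum (u := Finset.univ) fun (σ : Equiv.Perm n) _ =>
    (HasDerivAt.fun_finsetProd (u := Finset.univ) fun i (_ : i ∈ Finset.univ) =>
      h (σ i) i).const_smul (Equiv.Perm.sign σ : ℤ)
  refine hd.congr_deriv ?_
  rw [Finset.sum_eq_single 1]
  · simp [h1, Matrix.trace]
  · intro σ _ hσ
    rw [Finset.sum_eq_zero, smul_zero]
    intro i _
    obtain ⟨j, hji, hj⟩ : ∃ j, j ≠ i ∧ σ j ≠ j := by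
      by_contra! hc
      refine hσ (Equiv.ext fun j => ?_)
      by_cases hji : j = i
      · subst hji
        by_contra hne
        exact hne (σ.injective (hc (σ j) hne))
      · exact hc j hji
    rw [Finset.prod_eq_zero (Finset.mem_erase.mpr ⟨hji, Finset.mem_univ j⟩), zero_smul]
    rw [h1, Matrix.one_apply_ne hj]
  · simp

theorem hasDerivAt_matrix_mul {l m k : Type*} [Fintype m] {M : ℝ → Matrix l m ℂ}
    {N : ℝ → Matrix m k ℂ} {M' : Matrix l m ℂ} {N' : Matrix m k ℂ} {t : ℝ}
    (hM : ∀ i j, HasDerivAt (fun s => M s i j) (M' i j) t)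
    (hN : ∀ i j, HasDerivAt (fun s => N s i j) (N' i j) t) (i : l) (j : k) :
    HasDerivAt (fun s => (M s * N s) i j) ((M' * N t + M t * N') i j) t := by
  simp only [Matrix.mul_apply, Matrix.add_apply, ← Finset.sum_add_distrib]
  exact HasDerivAt.fun_sum fun a _ => (hM i a).mul (hN a j)

/-- Left multiplication by `(M t)⁻¹` reduces to the case of a curve through the identity. -/
theorem hasDerivAt_det {M : ℝ → Matrix n n ℂ} {M' : Matrix n n ℂ} {t : ℝ}
    (hu : IsUnit (M t).det) (h : ∀ i j, HasDerivAt (fun s => M s i j) (M' i j) t) :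
    HasDerivAt (fun s => (M s).det) ((M t).det * ((M t)⁻¹ * M').trace) t := by
  have h1 := (hasDerivAt_det_of_eq_one (M := fun s => (M t)⁻¹ * M s)
    (Matrix.nonsing_inv_mul _ hu)
    (hasDerivAt_matrix_mul (M' := 0) (fun i j => hasDerivAt_const t _) h)).const_mul (M t).det
  simp only [Matrix.det_mul, zero_mul, zero_add, ← mul_assoc, Matrix.det_nonsing_inv,
    Ring.mul_inverse_cancel _ hu, one_mul] at h1
  exact h1

/-- The adjugate formula gives differentiability. The value then follows by differentiating M⁻¹ M =
1, which holds near `t`. -/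
theorem hasDerivAt_matrix_inv {M : ℝ → Matrix n n ℂ} {M' : Matrix n n ℂ} {t : ℝ}
    (hu : IsUnit (M t).det) (h : ∀ i j, HasDerivAt (fun s => M s i j) (M' i j) t) (i j : n) :
    HasDerivAt (fun s => (M s)⁻¹ i j) (-((M t)⁻¹ * M' * (M t)⁻¹) i j) t := by
  have hdet := hasDerivAt_det hu h
  have hev : ∀ᶠ s in nhds t, IsUnit (M s).det :=
    (hdet.continuousAt.eventually_ne hu.ne_zero).mono fun s hs => isUnit_iff_ne_zero.mpr hs
  have hadj : ∀ i j, DifferentiableAt ℝ (fun s => (M s).adjugate i j) t := by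
    intro i j
    simp only [Matrix.adjugate_apply, Matrix.det_apply]
    refine DifferentiableAt.fun_sum fun σ _ => DifferentiableAt.const_smul ?_ _
    refine DifferentiableAt.fun_finsetProd fun k _ => ?_
    by_cases hk : σ k = j
    · simp [hk]
    · simpa [Matrix.updateRow_ne hk] using (h (σ k) k).differentiableAt
  have hinv : ∀ i j, DifferentiableAt ℝ (fun s => (M s)⁻¹ i j) t := by
    intro i j
    simp only [Matrix.inv_def, Matrix.smul_apply, Ring.inverse_eq_inv', smul_eq_mul]
    exact (hdet.differentiableAt.inv hu.ne_zero).mul (hadj i j)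
  set N' : Matrix n n ℂ := Matrix.of fun i j => deriv (fun s => (M s)⁻¹ i j) t with hN'
  have hN : ∀ i j, HasDerivAt (fun s => (M s)⁻¹ i j) (N' i j) t := fun i j =>
    (hinv i j).hasDerivAt
  have hprod := hasDerivAt_matrix_mul hN h
  have key : N' * M t + (M t)⁻¹ * M' = 0 := by
    ext a b
    refine (hprod a b).unique ?_
    refine (hasDerivAt_const t ((1 : Matrix n n ℂ) a b)).congr_of_eventuallyEq ?_
    filter_upwards [hev] with s hs
    rw [Matrix.nonsing_inv_mul _ hs]
  have e : N' = -((M t)⁻¹ * M' * (M t)⁻¹) := by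
    rw [← mul_one N', ← Matrix.mul_nonsing_inv _ hu, ← mul_assoc, eq_neg_of_add_eq_zero_left key,
      neg_mul]
  have := hN i j
  rwa [e] at this

/-- Differentiation of a complex Gaussian log-density along a curve of covariance matrices. -/
theorem hasDerivAt_log_cnDensity {M : ℝ → Matrix n n ℂ} {M' : Matrix n n ℂ} {t : ℝ}
    (hR : (M t).PosDef) (h : ∀ i j, HasDerivAt (fun s => M s i j) (M' i j) t) (x : n → ℂ) :
    HasDerivAt (fun s => Real.log (cnDensity (M s) x)) (cnScore (M t) M' x) t := by
  have hu : IsUnit (M t).det := (Matrix.isUnit_iff_isUnit_det _).mp hR.isUnit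
  obtain ⟨hre, him⟩ := Complex.pos_iff.mp hR.det_pos
  -- The determinant is real at `t`, so the real part of its product with the trace factors.
  have hdet : HasDerivAt (fun s => (M s).det.re) ((M t).det.re * ((M t)⁻¹ * M').trace.re) t := by
    have := Complex.reCLM.hasFDerivAt.comp_hasDerivAt t (hasDerivAt_det hu h)
    simpa [Function.comp_def, Complex.mul_re, ← him] using this
  have hq : HasDerivAt (fun s => (star x ⬝ᵥ ((M s)⁻¹ *ᵥ x)).re)
      (star x ⬝ᵥ (-((M t)⁻¹ * M' * (M t)⁻¹) *ᵥ x)).re t := by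
    have : HasDerivAt (fun s => star x ⬝ᵥ ((M s)⁻¹ *ᵥ x))
        (star x ⬝ᵥ (-((M t)⁻¹ * M' * (M t)⁻¹) *ᵥ x)) t := by
      simp only [dotProduct, Matrix.mulVec]
      exact HasDerivAt.fun_sum fun i _ => (HasDerivAt.fun_sum fun j _ =>
        (hasDerivAt_matrix_inv hu h i j).mul_const (x j)).const_mul _
    exact Complex.reCLM.hasFDerivAt.comp_hasDerivAt t this
  have hlog : ∀ᶠ s in nhds t, Real.log (cnDensity (M s) x) =
      -(Real.log (Real.pi ^ Fintype.card n) + Real.log (M s).det.re)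
        - (star x ⬝ᵥ ((M s)⁻¹ *ᵥ x)).re := by
    filter_upwards [hdet.continuousAt.eventually_ne hre.ne'] with s hs
    have hpi : Real.pi ^ Fintype.card n ≠ 0 := by positivity
    rw [cnDensity, Real.log_mul (inv_ne_zero (mul_ne_zero hpi hs)) (Real.exp_ne_zero _),
      Real.log_inv, Real.log_mul hpi hs, Real.log_exp, sub_eq_add_neg]
  refine ((((hdet.log hre.ne').const_add _).neg.sub hq).congr_of_eventuallyEq hlog).congr_deriv ?_
  rw [cnScore, mul_div_cancel_left₀ _ hre.ne', Matrix.neg_mulVec, dotProduct_neg, Complex.neg_re]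
  ring

end Derivatives

/-! ### The Fisher inner product on Hermitian directions -/

section CovInner

variable {n : Type*} [Fintype n] [DecidableEq n]

theorem cnScore_add (R A B : Matrix n n ℂ) (x : n → ℂ) :
    cnScore R (A + B) x = cnScore R A x + cnScore R B x := by
  simp only [cnScore, mul_add, add_mul, Matrix.add_mulVec, dotProduct_add, Matrix.trace_add,
    Complex.add_re]
  ring

theorem covInner_comm (R A B : Matrix n n ℂ) : covInner R A B = covInner R B A := by
  rw [covInner, covInner, mul_assoc (R⁻¹ * A), Matrix.trace_mul_comm, ← mul_assoc]

theorem covInner_add_left (R A B C : Matrix n n ℂ) :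
    covInner R (A + B) C = covInner R A C + covInner R B C := by
  simp only [covInner, mul_add, add_mul, Matrix.trace_add, Complex.add_re]

theorem covInner_add_right (R A B C : Matrix n n ℂ) :
    covInner R A (B + C) = covInner R A B + covInner R A C := by
  rw [covInner_comm, covInner_add_left, covInner_comm R B, covInner_comm R C]

theorem covInner_smul_left (R A B : Matrix n n ℂ) (c : ℝ) :
    covInner R ((c : ℂ) • A) B = c * covInner R A B := by
  simp only [covInner, mul_smul_comm, smul_mul_assoc, Matrix.trace_smul, smul_eq_mul,
    Complex.re_ofReal_mul]

theorem covInner_sum_left {ι : Type*} (s : Finset ι) (R B : Matrix n n ℂ)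
    (A : ι → Matrix n n ℂ) : covInner R (∑ i ∈ s, A i) B = ∑ i ∈ s, covInner R (A i) B := by
  simp only [covInner, Matrix.mul_sum, Matrix.sum_mul, Matrix.trace_sum, Complex.re_sum]

theorem covInner_sum_smul_left {ι : Type*} (s : Finset ι) (R B : Matrix n n ℂ)
    (A : ι → Matrix n n ℂ) (c : ι → ℝ) :
    covInner R (∑ i ∈ s, (c i : ℂ) • A i) B = ∑ i ∈ s, c i * covInner R (A i) B := by
  simp only [covInner_sum_left, covInner_smul_left]

theorem covInner_sum_smul_right {ι : Type*} (s : Finset ι) (R B : Matrix n n ℂ)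
    (A : ι → Matrix n n ℂ) (c : ι → ℝ) :
    covInner R B (∑ i ∈ s, (c i : ℂ) • A i) = ∑ i ∈ s, c i * covInner R B (A i) := by
  simp only [covInner_comm R B, covInner_sum_smul_left]

/-- In simultaneous diagonal coordinates the quantity is ∑ dᵢ², which vanishes only when A does. -/
theorem covInner_self_pos {R A : Matrix n n ℂ} (hR : R.PosDef) (hA : A.IsHermitian)
    (hA0 : A ≠ 0) : 0 < covInner R A A := by
  obtain ⟨C, d, hC, rfl, rfl⟩ := exists_simultaneous_diagonalization hR hA
  have hC' : IsUnit Cᴴ.det := by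
    rw [Matrix.det_conjTranspose]
    exact hC.star
  have c1 : ∀ X : Matrix n n ℂ, C⁻¹ * (C * X) = X := fun X => by
    rw [← mul_assoc, Matrix.nonsing_inv_mul _ hC, one_mul]
  have c2 : ∀ X : Matrix n n ℂ, Cᴴ * ((Cᴴ)⁻¹ * X) = X := fun X => by
    rw [← mul_assoc, Matrix.mul_nonsing_inv _ hC', one_mul]
  have h : covInner (C * Cᴴ) (C * Matrix.diagonal (fun i => (d i : ℂ)) * Cᴴ)
      (C * Matrix.diagonal (fun i => (d i : ℂ)) * Cᴴ) = ∑ i, d i ^ 2 := by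
    rw [covInner, Matrix.mul_inv_rev]
    simp only [mul_assoc, c1, c2]
    rw [Matrix.trace_mul_comm]
    simp only [mul_assoc, Matrix.mul_nonsing_inv _ hC', mul_one, Matrix.diagonal_mul_diagonal,
      Matrix.trace_diagonal, Complex.re_sum, ← Complex.ofReal_mul, Complex.ofReal_re, pow_two]
  rw [h]
  refine lt_of_le_of_ne (Finset.sum_nonneg fun i _ => sq_nonneg _) fun h0 => hA0 ?_
  have hd : ∀ i, d i = 0 := fun i => by
    simpa using (Finset.sum_eq_zero_iff_of_nonneg fun i _ => sq_nonneg (d i)).mp h0.symm i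
      (Finset.mem_univ i)
  simp [hd]

end CovInner

/-! ### Fisher information of independent Gaussian snapshots -/

section FisherInformation

variable {P n : Type*} [DecidableEq P] [Fintype n] [DecidableEq n]

theorem cnDensity_pos {R : Matrix n n ℂ} (hR : R.PosDef) (x : n → ℂ) : 0 < cnDensity R x := by
  have := (Complex.pos_iff.mp hR.det_pos).1
  have := Real.pi_pos
  unfold cnDensity
  positivity

/-- Fisher information of independent circular complex Gaussian snapshots whose covariance
matrix is a differentiable function of real parameters (the Slepian-Bangs formula). -/
theorem fisherInformation_cn (L : ℕ) {M : (P → ℝ) → Matrix n n ℂ} {dM : P → Matrix n n ℂ}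
    {ω : P → ℝ} (hM : (M ω).PosDef) (hH : ∀ i, (dM i).IsHermitian)
    (hd : ∀ i a b, HasDerivAt (fun t => M (Function.update ω i t) a b) (dM i a b) (ω i)) :
    HasFisherInformation (fun ω (x : Fin L → n → ℂ) => ∏ l, cnDensity (M ω) (x l)) ω ∧
      fisherInformation (fun ω (x : Fin L → n → ℂ) => ∏ l, cnDensity (M ω) (x l)) ω =
        Matrix.of fun i j => (L : ℝ) * covInner (M ω) (dM i) (dM j) := by
  have hω : ∀ i, M (Function.update ω i (ω i)) = M ω := fun i => by
    rw [Function.update_eq_self]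
  have hpos : ∀ x : Fin L → n → ℂ, 0 < ∏ l, cnDensity (M ω) (x l) := fun x =>
    Finset.prod_pos fun l _ => cnDensity_pos hM _
  have hder : ∀ i (x : Fin L → n → ℂ), HasDerivAt
      (fun t => Real.log (∏ l, cnDensity (M (Function.update ω i t)) (x l)))
      (∑ l, cnScore (M ω) (dM i) (x l)) (ω i) := by
    intro i x
    have h1 : ∀ l, HasDerivAt (fun t => Real.log (cnDensity (M (Function.update ω i t)) (x l)))
        (cnScore (M ω) (dM i) (x l)) (ω i) := by
      intro l
      have := hasDerivAt_log_cnDensity (M := fun t => M (Function.update ω i t))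
        (by rw [hω]; exact hM) (hd i) (x l)
      rwa [hω] at this
    have hu : IsUnit (M (Function.update ω i (ω i))).det := by
      rw [hω]
      exact (Matrix.isUnit_iff_isUnit_det _).mp hM.isUnit
    have hdet := Complex.continuous_re.continuousAt.comp (hasDerivAt_det hu (hd i)).continuousAt
    have hne : ∀ᶠ t in nhds (ω i), (M (Function.update ω i t)).det.re ≠ 0 := by
      refine hdet.eventually_ne ?_
      rw [Function.comp_apply, hω]
      exact (Complex.pos_iff.mp hM.det_pos).1.ne'
    refine (HasDerivAt.fun_sum fun l _ => h1 l).congr_of_eventuallyEq ?_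
    filter_upwards [hne] with t ht
    refine Real.log_prod fun l _ => ?_
    have := Real.pi_ne_zero
    exact mul_ne_zero (inv_ne_zero (mul_ne_zero (pow_ne_zero _ this) ht)) (Real.exp_ne_zero _)
  have hscore : ∀ i (x : Fin L → n → ℂ),
      score (fun ω (x : Fin L → n → ℂ) => ∏ l, cnDensity (M ω) (x l)) ω i x =
        ∑ l, cnScore (M ω) (dM i) (x l) := fun i x => (hder i x).deriv
  have hmom : ∀ A : Matrix n n ℂ, A.IsHermitian →
      CentredMoments (fun x : Fin L → n → ℂ => ∏ l, cnDensity (M ω) (x l))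
        (fun x => ∑ l, cnScore (M ω) A (x l)) ((L : ℝ) * covInner (M ω) A A) := by
    intro A hA
    have h := centredMoments_cnScore hM hA
    simpa using CentredMoments.sum (ι := Fin L) h.integrable h.integral_eq_one fun _ => h
  -- Polarization: the score is additive in the direction, so products of scores reduce to squares,
  -- whose moments are known.
  have hpol : ∀ i j, (fun x : Fin L → n → ℂ =>
      (∑ l, cnScore (M ω) (dM i) (x l)) * (∑ l, cnScore (M ω) (dM j) (x l)) *
        ∏ l, cnDensity (M ω) (x l)) =
      fun x => 2⁻¹ * ((∑ l, cnScore (M ω) (dM i + dM j) (x l)) ^ 2 * ∏ l, cnDensity (M ω) (x l)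
        - (∑ l, cnScore (M ω) (dM i) (x l)) ^ 2 * ∏ l, cnDensity (M ω) (x l)
        - (∑ l, cnScore (M ω) (dM j) (x l)) ^ 2 * ∏ l, cnDensity (M ω) (x l)) := by
    intro i j
    ext x
    simp only [cnScore_add, Finset.sum_add_distrib]
    ring
  -- The zero direction serves only to extract integrability and total mass of the density.
  have h0 := hmom 0 Matrix.isHermitian_zero
  have hi := fun i => hmom _ (hH i)
  have hij := fun i j => hmom _ ((hH i).add (hH j))
  refine ⟨⟨hpos, h0.integrable, h0.integral_eq_one, fun i x => (hder i x).differentiableAt, ?_⟩, ?_⟩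
  · intro i j
    simp only [hscore]
    rw [hpol]
    exact (((hij i j).integrable_two.sub (hi i).integrable_two).sub
      (hi j).integrable_two).const_mul _
  · ext i j
    have h12 : Integrable fun x : Fin L → n → ℂ =>
        (∑ l, cnScore (M ω) (dM i + dM j) (x l)) ^ 2 * ∏ l, cnDensity (M ω) (x l)
          - (∑ l, cnScore (M ω) (dM i) (x l)) ^ 2 * ∏ l, cnDensity (M ω) (x l) :=
      (hij i j).integrable_two.sub (hi i).integrable_two
    simp only [fisherInformation, Matrix.of_apply, hscore]
    rw [hpol, integral_const_mul, integral_sub h12 (hi j).integrable_two,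
      integral_sub (hij i j).integrable_two (hi i).integrable_two, (hij i j).integral_two,
      (hi i).integral_two, (hi j).integral_two, covInner_add_left, covInner_add_right,
      covInner_add_right, covInner_comm _ (dM j) (dM i)]
    ring

end FisherInformation

/-! ### Schur complements and block inverses -/

section BlockMatrices

/-- `C` holds the regression coefficients of the parameters of interest on the nuisance ones, and
`W` is the residual information. -/
theorem efficientInformation_eq_of_decomposition {E V : Type*} [Fintype V]
    [DecidableEq V] {J : Matrix (E ⊕ V) (E ⊕ V) ℝ} {C : Matrix E V ℝ} {W : Matrix E E ℝ}
    (hu : IsUnit J.toBlocks₂₂.det) (h12 : J.toBlocks₁₂ = C * J.toBlocks₂₂) (h21 : J.toBlocks₂₁ = J.toBlocks₂₂ * Cᵀ)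
    (h11 : J.toBlocks₁₁ = W + C * J.toBlocks₂₂ * Cᵀ) : efficientInformation J = W := by
  rw [efficientInformation, h11, h12, h21, Matrix.mul_nonsing_inv_cancel_right _ _ hu,
    ← Matrix.mul_assoc, add_sub_cancel_right]

variable {E V : Type*} [Fintype E] [DecidableEq E] [Fintype V] [DecidableEq V]

theorem isUnit_det_iff_efficientInformation {J : Matrix (E ⊕ V) (E ⊕ V) ℝ}
    (hu : IsUnit J.toBlocks₂₂.det) :
    IsUnit J.det ↔ IsUnit (efficientInformation J).det := by
  let := Matrix.invertibleOfIsUnitDet _ hu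
  conv_lhs => rw [← Matrix.fromBlocks_toBlocks J, Matrix.det_fromBlocks₂₂, IsUnit.mul_iff]
  rw [Matrix.invOf_eq_nonsing_inv]
  exact and_iff_right hu

theorem cramerRaoBound_eq_inv {J : Matrix (E ⊕ V) (E ⊕ V) ℝ} (hu : IsUnit J.toBlocks₂₂.det)
    (hF : IsUnit (efficientInformation J).det) :
    cramerRaoBound J = (efficientInformation J)⁻¹ := by
  have hJ := (isUnit_det_iff_efficientInformation hu).mpr hF
  let i1 := Matrix.invertibleOfIsUnitDet _ hu
  have hF' : IsUnit (J.toBlocks₁₁ - J.toBlocks₁₂ * ⅟J.toBlocks₂₂ * J.toBlocks₂₁).det := by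
    rw [Matrix.invOf_eq_nonsing_inv]
    exact hF
  let i2 := Matrix.invertibleOfIsUnitDet _ hF'
  let i3 : Invertible (Matrix.fromBlocks J.toBlocks₁₁ J.toBlocks₁₂ J.toBlocks₂₁ J.toBlocks₂₂) := by
    rw [Matrix.fromBlocks_toBlocks]
    exact Matrix.invertibleOfIsUnitDet _ hJ
  have h := Matrix.invOf_fromBlocks₂₂_eq J.toBlocks₁₁ J.toBlocks₁₂ J.toBlocks₂₁ J.toBlocks₂₂
  simp only [Matrix.invOf_eq_nonsing_inv, Matrix.fromBlocks_toBlocks] at h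
  rw [cramerRaoBound, h, Matrix.toBlocks_fromBlocks₁₁, efficientInformation]

/-- With an empty second block the Schur complement is the first block itself. This serves the
purely far-field case, and its mirror image below the purely near-field one. -/
theorem inv_toBlocks₁₁_of_isEmpty [IsEmpty V] (J : Matrix (E ⊕ V) (E ⊕ V) ℝ)
    (h : IsUnit J.toBlocks₁₁.det) : IsUnit J.det ∧ (J⁻¹).toBlocks₁₁ = J.toBlocks₁₁⁻¹ := by
  have h22 : IsUnit J.toBlocks₂₂.det := by
    rw [Matrix.det_isEmpty]
    exact isUnit_one
  have he : efficientInformation J = J.toBlocks₁₁ := by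
    ext i j
    simp [efficientInformation, Matrix.mul_apply]
  rw [← he] at h ⊢
  exact ⟨(isUnit_det_iff_efficientInformation h22).mpr h, cramerRaoBound_eq_inv h22 h⟩

theorem inv_toBlocks₂₂_of_isEmpty [IsEmpty E] (J : Matrix (E ⊕ V) (E ⊕ V) ℝ)
    (h : IsUnit J.toBlocks₂₂.det) : IsUnit J.det ∧ (J⁻¹).toBlocks₂₂ = J.toBlocks₂₂⁻¹ := by
  have h' := inv_toBlocks₁₁_of_isEmpty (J.submatrix (Equiv.sumComm V E) (Equiv.sumComm V E)) h
  rw [Matrix.det_submatrix_equiv_self, Matrix.inv_submatrix_equiv] at h'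
  exact h'

end BlockMatrices

/-! ### Gram matrices and elimination of nuisance directions -/

section Gram

variable {E V n : Type*} [Fintype V] [DecidableEq V] [Fintype n]
  [DecidableEq n]

/-- A kernel vector of the Gram matrix would give a nonzero Hermitian combination of the directions
with zero norm. -/
theorem isUnit_det_covInner_gram {R : Matrix n n ℂ} (hR : R.PosDef) {B : V → Matrix n n ℂ}
    (hB : ∀ v, (B v).IsHermitian) (hlin : ∀ c : V → ℝ, ∑ v, (c v : ℂ) • B v = 0 → c = 0)
    {a : ℝ} (ha : a ≠ 0) :
    IsUnit (Matrix.of fun v w => a * covInner R (B v) (B w)).det := by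
  rw [isUnit_iff_ne_zero]
  intro h
  obtain ⟨c, hc0, hc⟩ := Matrix.exists_mulVec_eq_zero_iff.mpr h
  have hA : (∑ v, (c v : ℂ) • B v).IsHermitian := by
    rw [Matrix.IsHermitian, Matrix.conjTranspose_sum]
    exact Finset.sum_congr rfl fun v _ => by
      rw [Matrix.conjTranspose_smul, (hB v).eq, RCLike.star_def, Complex.conj_ofReal]
  have hpos := covInner_self_pos hR hA fun h0 => hc0 (hlin c h0)
  have hz : a * covInner R (∑ v, (c v : ℂ) • B v) (∑ v, (c v : ℂ) • B v) = 0 := by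
    rw [covInner_sum_smul_left, Finset.mul_sum]
    refine Finset.sum_eq_zero fun v _ => ?_
    have := congrFun hc v
    simp only [Matrix.mulVec, dotProduct, Matrix.of_apply, Pi.zero_apply] at this
    rw [covInner_sum_smul_right, mul_left_comm, Finset.mul_sum,
      Finset.sum_congr rfl fun w _ => (by ring :
        a * (c w * covInner R (B v) (B w)) = a * covInner R (B v) (B w) * c w), this, mul_zero]
  exact (mul_ne_zero ha hpos.ne') hz

/-- The efficient information is the Gram matrix of the components of the directions of interest
that are orthogonal to the nuisance directions. -/
theorem efficientInformation_covInner (R : Matrix n n ℂ) {B : E ⊕ V → Matrix n n ℂ}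
    {W : E → Matrix n n ℂ} {C : Matrix E V ℝ} {a : ℝ}
    (hu : IsUnit (Matrix.of fun v w => a * covInner R (B (.inr v)) (B (.inr w))).det)
    (hB : ∀ i, B (.inl i) = W i + ∑ v, (C i v : ℂ) • B (.inr v))
    (hW : ∀ i v, covInner R (W i) (B (.inr v)) = 0) :
    efficientInformation (Matrix.of fun i j => a * covInner R (B i) (B j)) =
      Matrix.of fun i j => a * covInner R (W i) (W j) := by
  have h12 : ∀ i v, covInner R (B (.inl i)) (B (.inr v)) =
      ∑ w, C i w * covInner R (B (.inr w)) (B (.inr v)) := fun i v => by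
    rw [hB, covInner_add_left, hW, zero_add, covInner_sum_smul_left]
  have hWj : ∀ i j, covInner R (W i) (B (.inl j)) = covInner R (W i) (W j) := fun i j => by
    rw [hB j, covInner_add_right, covInner_sum_smul_right]
    simp [hW]
  refine efficientInformation_eq_of_decomposition (C := C) hu ?_ ?_ ?_
  · ext i v
    simp only [Matrix.toBlocks₁₂, Matrix.toBlocks₂₂, Matrix.mul_apply, Matrix.of_apply, h12,
      Finset.mul_sum]
    exact Finset.sum_congr rfl fun w _ => by ring
  · ext v i
    simp only [Matrix.toBlocks₂₁, Matrix.toBlocks₂₂, Matrix.mul_apply, Matrix.of_apply,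
      covInner_comm R _ (B (.inl i)), h12, Finset.mul_sum, Matrix.transpose_apply]
    exact Finset.sum_congr rfl fun w _ => by
      rw [covInner_comm]
      ring
  · ext i j
    simp only [Matrix.toBlocks₁₁, Matrix.toBlocks₂₂, Matrix.mul_apply, Matrix.of_apply,
      Matrix.add_apply, Matrix.transpose_apply]
    rw [show covInner R (B (.inl i)) (B (.inl j)) = covInner R (W i) (W j) +
        ∑ v, C i v * covInner R (B (.inr v)) (B (.inl j)) by
      conv_lhs => rw [hB i]
      rw [covInner_add_left, covInner_sum_smul_left, hWj]]
    simp only [covInner_comm R _ (B (.inl j)), h12, mul_add, Finset.mul_sum, Finset.sum_mul]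
    rw [Finset.sum_comm]
    congr 1
    refine Finset.sum_congr rfl fun w _ => Finset.sum_congr rfl fun v _ => ?_
    rw [covInner_comm]
    ring

end Gram

/-! ### Nonsingularity from full column rank and positive noise -/

section FullColumnRank

variable {m k : Type*} [Fintype m] [Fintype k] {G : Matrix m k ℂ}

theorem isUnit_det_gram [DecidableEq k] (hG : LinearIndependent ℂ G.col) :
    IsUnit (Gᴴ * G).det :=
  (Matrix.isUnit_iff_isUnit_det _).mp
    (Matrix.PosDef.conjTranspose_mul_self G (Matrix.mulVec_injective_iff.mpr hG)).isUnit

theorem posDef_signal_add_noise [DecidableEq m] (G : Matrix m k ℂ) {S : Matrix k k ℂ}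
    (hS : S.PosDef) {s : ℝ} (hs : 0 < s) : (G * S * Gᴴ + (s : ℂ) • 1).PosDef :=
  Matrix.PosDef.posSemidef_add (hS.posSemidef.mul_mul_conjTranspose_same G)
    (Matrix.PosDef.one.smul (by exact_mod_cast hs))

end FullColumnRank

/-! ### The noise-subspace projector and orthogonal directions -/

section Projection

variable {m k : Type*} [Fintype m] [DecidableEq m] [Fintype k] [DecidableEq k]
  {G : Matrix m k ℂ}

theorem projPerp_mul (hu : IsUnit (Gᴴ * G).det) : projPerp G * G = 0 := by
  rw [projPerp, Matrix.sub_mul, Matrix.one_mul, Matrix.mul_assoc, Matrix.mul_assoc,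
    Matrix.nonsing_inv_mul _ hu, Matrix.mul_one, sub_self]

theorem projPerp_conjTranspose (G : Matrix m k ℂ) : (projPerp G)ᴴ = projPerp G := by
  simp only [projPerp, Matrix.conjTranspose_sub, Matrix.conjTranspose_one,
    Matrix.conjTranspose_mul, Matrix.conjTranspose_conjTranspose,
    Matrix.conjTranspose_nonsing_inv, Matrix.mul_assoc]

theorem conjTranspose_mul_projPerp (hu : IsUnit (Gᴴ * G).det) : Gᴴ * projPerp G = 0 := by
  have := congrArg Matrix.conjTranspose (projPerp_mul hu)
  rwa [Matrix.conjTranspose_mul, projPerp_conjTranspose, Matrix.conjTranspose_zero] at this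

theorem projPerp_mul_self (hu : IsUnit (Gᴴ * G).det) : projPerp G * projPerp G = projPerp G := by
  conv_lhs => arg 2; rw [projPerp]
  rw [Matrix.mul_sub, Matrix.mul_one, ← Matrix.mul_assoc, ← Matrix.mul_assoc, projPerp_mul hu,
    Matrix.zero_mul, Matrix.zero_mul, sub_zero]

/-- This shows that the projector is nonzero when K < N, which separates the noise power from the
source covariance. -/
theorem trace_projPerp (hu : IsUnit (Gᴴ * G).det) :
    (projPerp G).trace = Fintype.card m - Fintype.card k := by
  rw [projPerp, Matrix.trace_sub, Matrix.trace_one, Matrix.mul_assoc, Matrix.trace_mul_comm,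
    Matrix.mul_assoc, Matrix.nonsing_inv_mul _ hu, Matrix.trace_one]

variable {S : Matrix k k ℂ} {s : ℝ}

/-- The signal part of R kills the range of the projector, so R acts there as the scalar `s`. -/
theorem inv_mul_projPerp (hu : IsUnit (Gᴴ * G).det) (hs : s ≠ 0)
    (hR : IsUnit (G * S * Gᴴ + (s : ℂ) • 1).det) :
    (G * S * Gᴴ + (s : ℂ) • 1)⁻¹ * projPerp G = (s : ℂ)⁻¹ • projPerp G := by
  have h : (G * S * Gᴴ + (s : ℂ) • 1) * projPerp G = (s : ℂ) • projPerp G := by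
    rw [add_mul, Matrix.mul_assoc _ Gᴴ, conjTranspose_mul_projPerp hu, Matrix.mul_zero, zero_add,
      smul_mul_assoc, one_mul]
  have hs' : (s : ℂ) ≠ 0 := by exact_mod_cast hs
  rw [eq_inv_smul_iff₀ hs', ← mul_smul_comm, ← h, ← mul_assoc, Matrix.nonsing_inv_mul _ hR,
    one_mul]

theorem projPerp_mul_inv (hu : IsUnit (Gᴴ * G).det) (hs : s ≠ 0)
    (hR : IsUnit (G * S * Gᴴ + (s : ℂ) • 1).det) :
    projPerp G * (G * S * Gᴴ + (s : ℂ) • 1)⁻¹ = (s : ℂ)⁻¹ • projPerp G := by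
  have h : projPerp G * (G * S * Gᴴ + (s : ℂ) • 1) = (s : ℂ) • projPerp G := by
    rw [mul_add, ← Matrix.mul_assoc, ← Matrix.mul_assoc, projPerp_mul hu, Matrix.zero_mul,
      Matrix.zero_mul, zero_add, mul_smul_comm, mul_one]
  have hs' : (s : ℂ) ≠ 0 := by exact_mod_cast hs
  rw [eq_inv_smul_iff₀ hs', ← smul_mul_assoc, ← h, mul_assoc, Matrix.mul_nonsing_inv _ hR,
    mul_one]

/-- The component, orthogonal to the nuisance directions, of the direction in which the covariance
matrix moves when `G` moves in the direction `D`. -/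
def orthDir (G D : Matrix m k ℂ) (S : Matrix k k ℂ) : Matrix m m ℂ :=
  projPerp G * (D * S * Gᴴ) + G * S * Dᴴ * projPerp G

/-- The hypotheses on `B` cover both kinds of nuisance direction: `c = 0` for G H Gᴴ and `c = 1` for
the identity. Moving the projector through R⁻¹ and `B` brings it next to Gᴴ or G, where the product
vanishes. -/
theorem covInner_orthDir_eq_zero (hu : IsUnit (Gᴴ * G).det) (hs : s ≠ 0)
    (hR : IsUnit (G * S * Gᴴ + (s : ℂ) • 1).det) (D : Matrix m k ℂ) {B : Matrix m m ℂ} {c : ℂ}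
    (hB1 : B * projPerp G = c • projPerp G) (hB2 : projPerp G * B = c • projPerp G) :
    covInner (G * S * Gᴴ + (s : ℂ) • 1) (orthDir G D S) B = 0 := by
  have h1 := inv_mul_projPerp hu hs hR
  have h2 := projPerp_mul_inv hu hs hR
  have hX : D * S * Gᴴ * projPerp G = 0 := by
    rw [Matrix.mul_assoc, conjTranspose_mul_projPerp hu, Matrix.mul_zero]
  have hY : projPerp G * (G * S * Dᴴ) = 0 := by
    rw [← Matrix.mul_assoc, ← Matrix.mul_assoc, projPerp_mul hu, Matrix.zero_mul, Matrix.zero_mul]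
  rw [covInner, orthDir]
  generalize G * S * Gᴴ + (s : ℂ) • 1 = R at *
  generalize D * S * Gᴴ = X at *
  generalize G * S * Dᴴ = Y at *
  generalize projPerp G = Q at *
  have t1 : (R⁻¹ * (Q * X) * R⁻¹ * B).trace = 0 := by
    rw [← mul_assoc R⁻¹, h1, smul_mul_assoc, smul_mul_assoc, smul_mul_assoc, Matrix.trace_smul,
      mul_assoc, mul_assoc, Matrix.trace_mul_comm, mul_assoc, mul_assoc, hB1, mul_smul_comm, h1,
      smul_smul, mul_smul_comm, hX, smul_zero, Matrix.trace_zero, smul_zero]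
  have t2 : (R⁻¹ * (Y * Q) * R⁻¹ * B).trace = 0 := by
    rw [mul_assoc R⁻¹, mul_assoc Y, h2, mul_assoc R⁻¹, mul_assoc Y, smul_mul_assoc, hB2,
      smul_smul, mul_smul_comm, mul_smul_comm, Matrix.trace_smul, ← mul_assoc,
      Matrix.trace_mul_comm, ← mul_assoc, h2, smul_mul_assoc, hY, smul_zero, Matrix.trace_zero,
      smul_zero]
  rw [mul_add, add_mul, add_mul, Matrix.trace_add, t1, t2, add_zero, Complex.zero_re]

/-- Of the four products in the expansion, two contain Gᴴ Π or Π G and vanish. The other two have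
complex conjugate traces, whence the factor 2; R⁻¹ Π = s⁻¹ Π supplies the 1/s. -/
theorem covInner_orthDir (hu : IsUnit (Gᴴ * G).det) (hs : s ≠ 0) (hS : S.IsHermitian)
    (hR : IsUnit (G * S * Gᴴ + (s : ℂ) • 1).det) (D D' : Matrix m k ℂ) :
    covInner (G * S * Gᴴ + (s : ℂ) • 1) (orthDir G D S) (orthDir G D' S) =
      2 / s * (D'ᴴ * projPerp G * D *
        (S * Gᴴ * (G * S * Gᴴ + (s : ℂ) • 1)⁻¹ * G * S)).trace.re := by
  have h1 := inv_mul_projPerp hu hs hR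
  have h2 := projPerp_mul_inv hu hs hR
  have hQ := projPerp_conjTranspose G
  have hQQ := projPerp_mul_self hu
  have hX : D * S * Gᴴ * projPerp G = 0 := by
    rw [Matrix.mul_assoc, conjTranspose_mul_projPerp hu, Matrix.mul_zero]
  have hY : projPerp G * (G * S * D'ᴴ) = 0 := by
    rw [← Matrix.mul_assoc, ← Matrix.mul_assoc, projPerp_mul hu, Matrix.zero_mul, Matrix.zero_mul]
  have hRH : (G * S * Gᴴ + (s : ℂ) • 1)ᴴ = G * S * Gᴴ + (s : ℂ) • 1 := by
    simp only [Matrix.conjTranspose_add, Matrix.conjTranspose_mul, Matrix.conjTranspose_smul,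
      Matrix.conjTranspose_conjTranspose, Matrix.conjTranspose_one, hS.eq, RCLike.star_def,
      Complex.conj_ofReal, Matrix.mul_assoc]
  have hXY : ∀ D : Matrix m k ℂ, (D * S * Gᴴ)ᴴ = G * S * Dᴴ := fun D => by
    simp only [Matrix.conjTranspose_mul, Matrix.conjTranspose_conjTranspose, hS.eq,
      Matrix.mul_assoc]
  have htr : (D'ᴴ * projPerp G * D *
      (S * Gᴴ * (G * S * Gᴴ + (s : ℂ) • 1)⁻¹ * G * S)).trace =
      (D * S * Gᴴ * (G * S * Gᴴ + (s : ℂ) • 1)⁻¹ * (G * S * D'ᴴ) * projPerp G).trace := by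
    rw [Matrix.mul_assoc _ D, Matrix.trace_mul_comm]
    simp only [Matrix.mul_assoc]
  rw [htr, covInner, orthDir, orthDir, ← hXY D, ← hXY D'] at *
  generalize G * S * Gᴴ + (s : ℂ) • 1 = R at *
  generalize D * S * Gᴴ = X at *
  generalize D' * S * Gᴴ = Y at *
  generalize projPerp G = Q at *
  have e1 : (R⁻¹ * (Q * X + Xᴴ * Q) * R⁻¹ * (Q * Y + Yᴴ * Q)).trace =
      (s : ℂ)⁻¹ * (X * R⁻¹ * Yᴴ * Q).trace + (s : ℂ)⁻¹ * (R⁻¹ * (Xᴴ * (Q * Y))).trace := by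
    have t1 : R⁻¹ * (Q * X) * R⁻¹ * (Q * Y) = 0 := by
      rw [mul_assoc (R⁻¹ * (Q * X)), ← mul_assoc R⁻¹ Q Y, h1, smul_mul_assoc, mul_smul_comm,
        mul_assoc, mul_assoc Q, ← mul_assoc X, hX, zero_mul, mul_zero, mul_zero, smul_zero]
    have t2 : (R⁻¹ * (Q * X) * R⁻¹ * (Yᴴ * Q)).trace =
        (s : ℂ)⁻¹ * (X * R⁻¹ * Yᴴ * Q).trace := by
      rw [← mul_assoc R⁻¹, h1, smul_mul_assoc, smul_mul_assoc, smul_mul_assoc, Matrix.trace_smul,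
        smul_eq_mul, mul_assoc, mul_assoc, Matrix.trace_mul_comm]
      simp only [mul_assoc, hQQ]
    have t3 : R⁻¹ * (Xᴴ * Q) * R⁻¹ * (Q * Y) = (s : ℂ)⁻¹ • (R⁻¹ * (Xᴴ * (Q * Y))) := by
      rw [mul_assoc R⁻¹, mul_assoc Xᴴ, h2, mul_smul_comm, mul_smul_comm, smul_mul_assoc]
      simp only [mul_assoc]
      rw [← mul_assoc Q Q, hQQ]
    have t4 : R⁻¹ * (Xᴴ * Q) * R⁻¹ * (Yᴴ * Q) = 0 := by
      rw [mul_assoc R⁻¹, mul_assoc Xᴴ, h2, mul_smul_comm, mul_smul_comm, smul_mul_assoc]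
      simp only [mul_assoc]
      rw [← mul_assoc Q, hY, zero_mul, mul_zero, mul_zero, smul_zero]
    rw [mul_add, mul_add, add_mul, add_mul, add_mul, t1, t3, t4, zero_add, add_zero,
      Matrix.trace_add, t2, Matrix.trace_smul, smul_eq_mul, add_comm]
  -- The two surviving products are adjoint to each other up to a cyclic shift under the trace.
  have e2 : (R⁻¹ * (Xᴴ * (Q * Y))).trace = star (X * R⁻¹ * Yᴴ * Q).trace := by
    rw [← Matrix.trace_conjTranspose]
    simp only [Matrix.conjTranspose_mul, Matrix.conjTranspose_conjTranspose,
      Matrix.conjTranspose_nonsing_inv, hRH, hQ]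
    rw [← mul_assoc R⁻¹, Matrix.trace_mul_comm, mul_assoc]
  rw [e1, e2, ← Complex.ofReal_inv, Complex.add_re, Complex.re_ofReal_mul, Complex.re_ofReal_mul,
    RCLike.star_def, Complex.conj_re]
  ring

end Projection

/-! ### Real coordinates of Hermitian matrices -/

section HermitianCoordinates

variable {K₁ K₂ : ℕ}

/-- `hermOfCoord` as a real-linear map. -/
def hermLin : (Tgt K₁ K₂ × Tgt K₁ K₂ → ℝ) →ₗ[ℝ] Matrix (Tgt K₁ K₂) (Tgt K₁ K₂) ℂ where
  toFun := hermOfCoord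
  map_add' c d := by
    ext i j
    simp only [hermOfCoord, Matrix.of_apply, Matrix.add_apply, Pi.add_apply]
    split_ifs <;> apply Complex.ext <;> simp [add_comm]
  map_smul' a c := by
    ext i j
    simp only [hermOfCoord, Matrix.of_apply, Matrix.smul_apply, Pi.smul_apply, RingHom.id_apply]
    split_ifs <;> apply Complex.ext <;> simp

theorem hermOfCoord_eq_sum (c : Tgt K₁ K₂ × Tgt K₁ K₂ → ℝ) :
    hermOfCoord c = ∑ q, (c q : ℂ) • hermOfCoord (Pi.single q 1) := by
  have h := LinearMap.pi_apply_eq_sum_univ hermLin c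
  refine h.trans (Finset.sum_congr rfl fun q _ => ?_)
  have e : (fun j => if q = j then (1 : ℝ) else 0) = Pi.single q 1 := by
    ext j
    simp [Pi.single_apply, eq_comm]
  rw [Complex.coe_smul, e]
  rfl

theorem hermOfCoord_isHermitian (c : Tgt K₁ K₂ × Tgt K₁ K₂ → ℝ) :
    (hermOfCoord c).IsHermitian := by
  ext i j
  rw [Matrix.conjTranspose_apply]
  by_cases h : i = j
  · subst h
    simp [hermOfCoord]
  · by_cases hlt : toLex i < toLex j
    · simp only [hermOfCoord, Matrix.of_apply, if_neg h, if_neg (Ne.symm h), if_pos hlt,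
        if_neg hlt.not_gt]
      apply Complex.ext <;> simp
    · have hgt : toLex j < toLex i :=
        lt_of_le_of_ne (not_lt.mp hlt) fun e => h (toLex.injective e).symm
      simp only [hermOfCoord, Matrix.of_apply, if_neg h, if_neg (Ne.symm h), if_pos hgt,
        if_neg hlt]
      apply Complex.ext <;> simp

theorem eq_zero_of_hermOfCoord_eq_zero {c : Tgt K₁ K₂ × Tgt K₁ K₂ → ℝ}
    (h : hermOfCoord c = 0) : c = 0 := by
  ext ⟨i, j⟩
  have hij := congrFun (congrFun h i) j
  have hji := congrFun (congrFun h j) i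
  simp only [hermOfCoord, Matrix.of_apply, Matrix.zero_apply] at hij hji
  by_cases e : i = j
  · subst e
    simpa using hij
  · by_cases hlt : toLex i < toLex j
    · rw [if_neg e, if_pos hlt] at hij
      exact congrArg Complex.re hij
    · have hgt : toLex j < toLex i :=
        lt_of_le_of_ne (not_lt.mp hlt) fun e' => e (toLex.injective e').symm
      -- A coordinate below the diagonal is the imaginary part of the transposed entry.
      rw [if_neg (Ne.symm e), if_pos hgt] at hji
      exact congrArg Complex.im hji

theorem hasDerivAt_hermOfCoord_update (c : Tgt K₁ K₂ × Tgt K₁ K₂ → ℝ)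
    (q : Tgt K₁ K₂ × Tgt K₁ K₂) (t : ℝ) (i j : Tgt K₁ K₂) :
    HasDerivAt (fun s => hermOfCoord (Function.update c q s) i j)
      (hermOfCoord (Pi.single q 1) i j) t := by
  have h : ∀ s, hermOfCoord (Function.update c q s) i j =
      hermOfCoord (Function.update c q 0) i j + (s : ℂ) * hermOfCoord (Pi.single q 1) i j := by
    intro s
    -- Along one coordinate the map is affine, with slope the image of the basis vector.
    have e : Function.update c q s = Function.update c q 0 + s • Pi.single q 1 := by
      ext p
      by_cases hp : p = q
      · subst hp
        simp
      · simp [hp]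
    have hl := (hermLin.map_add (Function.update c q 0) (s • Pi.single q 1)).trans
      (congrArg _ (hermLin.map_smul s (Pi.single q 1)))
    rw [← e] at hl
    have := congrFun (congrFun hl i) j
    simpa [hermLin] using this
  rw [funext h]
  simpa using ((Complex.ofRealCLM.hasDerivAt (x := t)).mul_const
    (hermOfCoord (Pi.single q 1) i j)).const_add (hermOfCoord (Function.update c q 0) i j)

end HermitianCoordinates

/-! ### Differentiability of the steering vectors -/

section Differentiability

theorem differentiableAt_ofReal_comp {f : ℝ → ℝ} {t : ℝ} (hf : DifferentiableAt ℝ f t) :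
    DifferentiableAt ℝ (fun s => (f s : ℂ)) t :=
  Complex.ofRealCLM.differentiableAt.comp t hf

theorem differentiableAt_farSteering (lam : ℝ) {Nx Ny : ℕ} (n : Ant Nx Ny) {f g : ℝ → ℝ} {t : ℝ}
    (hf : DifferentiableAt ℝ f t) (hg : DifferentiableAt ℝ g t) :
    DifferentiableAt ℝ (fun s => farSteering lam (f s) (g s) n) t := by
  have hax : ∀ (m : ℕ) (i : Fin m) {γ : ℝ → ℝ}, DifferentiableAt ℝ γ t →
      DifferentiableAt ℝ (fun s => axisResponse lam m (γ s) i) t := by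
    intro m i γ hγ
    exact ((differentiableAt_ofReal_comp (hγ.const_mul _)).const_mul Complex.I).cexp
  exact (hax Ny n.1 (hf.sin.mul hg.sin)).mul (hax Nx n.2 (hf.sin.mul hg.cos))

theorem differentiableAt_antennaRange (lam : ℝ) {Nx Ny : ℕ} (mdl : NearModel) (n : Ant Nx Ny)
    {ρ f g : ℝ → ℝ} {t : ℝ} (hρ : DifferentiableAt ℝ ρ t) (hf : DifferentiableAt ℝ f t)
    (hg : DifferentiableAt ℝ g t) (h0 : ρ t ≠ 0)
    (hn : mdl = .spherical → antennaRange lam mdl (ρ t) (f t) (g t) n ≠ 0) :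
    DifferentiableAt ℝ (fun s => antennaRange lam mdl (ρ s) (f s) (g s) n) t := by
  have ha : DifferentiableAt ℝ (fun s => alpha (f s) (g s)) t := hf.sin.mul hg.cos
  have hb : DifferentiableAt ℝ (fun s => beta (f s) (g s)) t := hf.sin.mul hg.sin
  cases mdl with
  | fresnel =>
    simp only [antennaRange]
    have : 2 * ρ t ≠ 0 := mul_ne_zero two_ne_zero h0
    fun_prop (disch := assumption)
  | spherical =>
    have hn := hn rfl
    simp only [antennaRange] at hn ⊢
    -- The square root is smooth away from zero, and a zero radicand would place the target at the
    -- antenna.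
    refine hρ.mul (DifferentiableAt.sqrt ?_ fun h => hn ?_)
    · have : ρ t ^ 2 ≠ 0 := pow_ne_zero 2 h0
      fun_prop (disch := assumption)
    · rw [h, Real.sqrt_zero, mul_zero]

variable {K₁ K₂ : ℕ} {Nx Ny : ℕ} {lam : ℝ} {mdl : NearModel} {η : EtaIdx K₁ K₂ → ℝ}

theorem differentiableAt_asm (hr : ∀ k : Fin K₂, η (.inr (2, k)) ≠ 0)
    (hant : mdl = .spherical → ∀ (k : Fin K₂) (n : Ant Nx Ny),
      antennaRange lam mdl (η (.inr (2, k))) (η (.inr (0, k))) (η (.inr (1, k))) n ≠ 0)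
    (i : EtaIdx K₁ K₂) (n : Ant Nx Ny) (k : Tgt K₁ K₂) :
    DifferentiableAt ℝ (fun t => asm Nx Ny lam mdl (Function.update η i t) n k) (η i) := by
  have hu : ∀ j, DifferentiableAt ℝ (fun t => Function.update η i t j) (η i) := fun j =>
    (hasDerivAt_pi.mp (hasDerivAt_update η i (η i)) j).differentiableAt
  cases k with
  | inl k => exact differentiableAt_farSteering lam n (hu _) (hu _)
  | inr k =>
    have hd := differentiableAt_antennaRange lam mdl n (hu (.inr (2, k))) (hu (.inr (0, k)))
      (hu (.inr (1, k))) (by rw [Function.update_eq_self]; exact hr k)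
      (by rw [Function.update_eq_self]; exact fun h => hant h k n)
    exact DifferentiableAt.const_mul (DifferentiableAt.cexp
      ((differentiableAt_ofReal_comp (((hd.sub (hu _)).const_mul _).div_const _)).const_mul
        Complex.I).neg) _

end Differentiability

/-! ### Derivatives of the steering matrix and of the covariance -/

section Derivative

variable {K₁ K₂ : ℕ} (Nx Ny : ℕ) (lam : ℝ) (mdl : NearModel) (η : EtaIdx K₁ K₂ → ℝ)

/-- Partial derivative of the array steering matrix. -/
def asmDeriv (i : EtaIdx K₁ K₂) : Matrix (Ant Nx Ny) (Tgt K₁ K₂) ℂ :=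
  Matrix.of fun n k => deriv (fun t => asm Nx Ny lam mdl (Function.update η i t) n k) (η i)

/-- The target to which a parameter of interest belongs. -/
def targetOf : EtaIdx K₁ K₂ → Tgt K₁ K₂ := Sum.map Prod.snd Prod.snd

/-- The columns of `[D_F, D_N]`. -/
def dirCol : Matrix (Ant Nx Ny) (EtaIdx K₁ K₂) ℂ :=
  Matrix.fromCols (farDeriv Nx Ny lam η) (nearDeriv Nx Ny lam mdl η)

/-- Only the column of its own target depends on a parameter. -/
theorem asmDeriv_apply (i : EtaIdx K₁ K₂) (n : Ant Nx Ny) (k : Tgt K₁ K₂) :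
    asmDeriv Nx Ny lam mdl η i n k =
      if k = targetOf i then dirCol Nx Ny lam mdl η n i else 0 := by
  have hconst : ∀ i : EtaIdx K₁ K₂, ∀ k, k ≠ targetOf i →
      deriv (fun t => asm Nx Ny lam mdl (Function.update η i t) n k) (η i) = 0 := by
    intro i k hk
    have : ∀ t, asm Nx Ny lam mdl (Function.update η i t) n k = asm Nx Ny lam mdl η n k := by
      intro t
      have hu : ∀ j, targetOf j = k → Function.update η i t j = η j := by
        intro j hj
        refine Function.update_of_ne ?_ _ _
        rintro rfl
        exact hk hj.symm
      rcases k with k | k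
      · simp only [asm, farASM, Matrix.fromCols_apply_inl, Matrix.of_apply]
        rw [hu (.inl (0, k)) rfl, hu (.inl (1, k)) rfl]
      · simp only [asm, nearASM, Matrix.fromCols_apply_inr, Matrix.of_apply]
        rw [hu (.inr (0, k)) rfl, hu (.inr (1, k)) rfl, hu (.inr (2, k)) rfl]
    simp only [this, deriv_const]
  split_ifs with h
  · subst h
    rcases i with ⟨p, k⟩ | ⟨p, k⟩
    · simp only [dirCol, Matrix.fromCols_apply_inl, farDeriv, asmDeriv, Matrix.of_apply]
      rw [Finset.sum_eq_single k]
      · rfl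
      · intro k' _ hk'
        refine hconst (.inl (p, k')) (.inl k) ?_
        simpa [targetOf] using hk'.symm
      · simp
    · simp only [dirCol, Matrix.fromCols_apply_inr, nearDeriv, asmDeriv, Matrix.of_apply]
      rw [Finset.sum_eq_single k]
      · rfl
      · intro k' _ hk'
        refine hconst (.inr (p, k')) (.inr k) ?_
        simpa [targetOf] using hk'.symm
      · simp
  · exact hconst i k h

/-- Each derivative has a single possibly nonzero column, so the trace collapses to one term. This
is where the Hadamard product comes from. -/
theorem trace_asmDeriv (i j : EtaIdx K₁ K₂) (Pi : Matrix (Ant Nx Ny) (Ant Nx Ny) ℂ)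
    (Q : Matrix (Tgt K₁ K₂) (Tgt K₁ K₂) ℂ) :
    ((asmDeriv Nx Ny lam mdl η j)ᴴ * Pi * asmDeriv Nx Ny lam mdl η i * Q).trace =
      ((dirCol Nx Ny lam mdl η)ᴴ * Pi * dirCol Nx Ny lam mdl η) j i *
        Q (targetOf i) (targetOf j) := by
  have h : ∀ a b, ((asmDeriv Nx Ny lam mdl η j)ᴴ * Pi * asmDeriv Nx Ny lam mdl η i) a b =
      if b = targetOf i then if a = targetOf j then
        ((dirCol Nx Ny lam mdl η)ᴴ * Pi * dirCol Nx Ny lam mdl η) j i else 0 else 0 := by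
    intro a b
    simp only [Matrix.mul_apply, Matrix.conjTranspose_apply, asmDeriv_apply]
    split_ifs <;> simp
  refine (Finset.sum_congr rfl fun a _ => Matrix.mul_apply).trans ?_
  simp only [h, ite_mul, zero_mul, Finset.sum_ite_eq', Finset.mem_univ, if_true]

variable (S : Matrix (Tgt K₁ K₂) (Tgt K₁ K₂) ℂ) (σsq : ℝ)

/-- One formula replaces the four blocks. The swapped target indices of Q account for the
transposes, and for Q₃ standing in the FN block and Q₂ in the NF block. -/
theorem closedFIM_apply (L : ℕ) (i j : EtaIdx K₁ K₂) :
    closedFIM Nx Ny lam mdl η S σsq L i j = 2 * (L : ℝ) / σsq *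
      (((dirCol Nx Ny lam mdl η)ᴴ * projPerp (asm Nx Ny lam mdl η) * dirCol Nx Ny lam mdl η) i j *
        qMat Nx Ny lam mdl η S σsq (targetOf j) (targetOf i)).re := by
  rcases i with ⟨p, k⟩ | ⟨p, k⟩ <;> rcases j with ⟨p', k'⟩ | ⟨p', k'⟩ <;>
  simp only [closedFIM, Matrix.smul_apply, smul_eq_mul, Matrix.fromBlocks_apply₁₁,
    Matrix.fromBlocks_apply₁₂, Matrix.fromBlocks_apply₂₁, Matrix.fromBlocks_apply₂₂, fimFF, fimFN,
    fimNF, fimNN, fimBlock, Matrix.map_apply, Matrix.hadamard_apply, Matrix.kroneckerMap_apply,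
    onesMat, Matrix.of_apply, one_mul, Matrix.transpose_apply] <;>
  rfl

/-- Partial derivative of the covariance matrix of a snapshot. -/
def covDeriv : ParIdx K₁ K₂ → Matrix (Ant Nx Ny) (Ant Nx Ny) ℂ
  | .inl i => asmDeriv Nx Ny lam mdl η i * S * (asm Nx Ny lam mdl η)ᴴ +
      asm Nx Ny lam mdl η * S * (asmDeriv Nx Ny lam mdl η i)ᴴ
  | .inr (.inl q) => asm Nx Ny lam mdl η * hermOfCoord (Pi.single q 1) * (asm Nx Ny lam mdl η)ᴴ
  | .inr (.inr _) => 1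

variable {S}

theorem covDeriv_isHermitian (hS : S.IsHermitian) (p : ParIdx K₁ K₂) :
    (covDeriv Nx Ny lam mdl η S p).IsHermitian := by
  rcases p with i | q | u
  · rw [Matrix.IsHermitian, covDeriv]
    simp only [Matrix.conjTranspose_add, Matrix.conjTranspose_mul,
      Matrix.conjTranspose_conjTranspose, hS.eq, Matrix.mul_assoc]
    exact add_comm _ _
  · exact Matrix.isHermitian_mul_mul_conjTranspose _ (hermOfCoord_isHermitian _)
  · exact Matrix.isHermitian_one

variable {Nx Ny lam mdl η}

theorem hasDerivAt_snapshotCov (hr : ∀ k : Fin K₂, η (.inr (2, k)) ≠ 0)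
    (hant : mdl = .spherical → ∀ (k : Fin K₂) (n : Ant Nx Ny),
      antennaRange lam mdl (η (.inr (2, k))) (η (.inr (0, k))) (η (.inr (1, k))) n ≠ 0)
    (hS : S.IsHermitian) (p : ParIdx K₁ K₂) (a b : Ant Nx Ny) :
    HasDerivAt (fun t => (fun ω : ParIdx K₁ K₂ → ℝ => snapshotCov Nx Ny lam mdl
        (fun i => ω (.inl i)) (hermOfCoord fun q => ω (.inr (.inl q))) (ω (.inr (.inr ()))))
        (Function.update (parVec η S σsq) p t) a b)
      (covDeriv Nx Ny lam mdl η S p a b) (parVec η S σsq p) := by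
  have hSc := hermOfCoord_hermCoord S hS
  rcases p with i | q | u
  · simp only [parVec, Sum.update_elim_inl, Sum.elim_inl, Sum.elim_inr, hSc]
    have hD : ∀ n k, HasDerivAt (fun t => asm Nx Ny lam mdl (Function.update η i t) n k)
        (asmDeriv Nx Ny lam mdl η i n k) (η i) := fun n k =>
      (differentiableAt_asm hr hant i n k).hasDerivAt
    have hDH : ∀ k n, HasDerivAt (fun t => (asm Nx Ny lam mdl (Function.update η i t))ᴴ k n)
        ((asmDeriv Nx Ny lam mdl η i)ᴴ k n) (η i) := fun k n => (hD n k).star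
    have h := hasDerivAt_matrix_mul (hasDerivAt_matrix_mul hD (N := fun _ => S) (N' := 0)
      fun _ _ => hasDerivAt_const _ _) hDH a b
    simp only [Function.update_eq_self, Matrix.mul_zero, add_zero] at h
    exact h.add_const _
  · simp only [parVec, Sum.update_elim_inr, Sum.update_elim_inl, Sum.elim_inl, Sum.elim_inr]
    have h := hasDerivAt_matrix_mul (hasDerivAt_matrix_mul
      (M := fun _ => asm Nx Ny lam mdl η) (M' := 0) (fun _ _ => hasDerivAt_const _ _)
      (hasDerivAt_hermOfCoord_update (hermCoord S) q (hermCoord S q)))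
      (N := fun _ => (asm Nx Ny lam mdl η)ᴴ) (N' := 0) (fun _ _ => hasDerivAt_const _ _) a b
    simp only [Matrix.mul_zero, Matrix.zero_mul, add_zero, zero_add] at h
    exact h.add_const _
  · simp only [parVec, Sum.update_elim_inr, Sum.elim_inl, Sum.elim_inr, hSc, snapshotCov,
      Function.update_self, covDeriv, Matrix.add_apply, Matrix.smul_apply, smul_eq_mul]
    simpa using ((Complex.ofRealCLM.hasDerivAt (x := σsq)).mul_const
      ((1 : Matrix (Ant Nx Ny) (Ant Nx Ny) ℂ) a b)).const_add
        ((asm Nx Ny lam mdl η * S * (asm Nx Ny lam mdl η)ᴴ) a b)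

end Derivative

/-! ### Nonsingular nuisance block and the closed form -/

section Assembly

variable {K₁ K₂ Nx Ny : ℕ} {lam : ℝ} {mdl : NearModel} {η : EtaIdx K₁ K₂ → ℝ}
  {S : Matrix (Tgt K₁ K₂) (Tgt K₁ K₂) ℂ} {σsq : ℝ}

theorem sum_smul_covDeriv_nuisance (c : NuisIdx K₁ K₂ → ℝ) :
    ∑ v, (c v : ℂ) • covDeriv Nx Ny lam mdl η S (.inr v) =
      asm Nx Ny lam mdl η * hermOfCoord (fun q => c (.inl q)) * (asm Nx Ny lam mdl η)ᴴ +
        (c (.inr ()) : ℂ) • 1 := by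
  rw [Fintype.sum_sum_type, hermOfCoord_eq_sum, Matrix.mul_sum, Matrix.sum_mul]
  simp [covDeriv]

/-- Multiplying G H Gᴴ + c I = 0 by the nonzero projector leaves c Π = 0, hence c = 0. Then Gᴴ on
the left and G on the right surround H by invertible Gram matrices, so H = 0. -/
theorem covDeriv_nuisance_linearIndependent (hK : K₁ + K₂ < Nx * Ny)
    (hG : LinearIndependent ℂ (asm Nx Ny lam mdl η).col) (c : NuisIdx K₁ K₂ → ℝ)
    (hc : ∑ v, (c v : ℂ) • covDeriv Nx Ny lam mdl η S (.inr v) = 0) : c = 0 := by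
  have hu := isUnit_det_gram hG
  rw [sum_smul_covDeriv_nuisance] at hc
  set G := asm Nx Ny lam mdl η
  have hP : projPerp G ≠ 0 := by
    intro h0
    have h := trace_projPerp hu
    rw [h0, Matrix.trace_zero, eq_comm, sub_eq_zero] at h
    simp only [Fintype.card_prod, Fintype.card_sum, Fintype.card_fin] at h
    have h' : Ny * Nx = K₁ + K₂ := by exact_mod_cast h
    rw [mul_comm] at h'
    omega
  have h1 : c (.inr ()) = 0 := by
    have h := congrArg (projPerp G * ·) hc
    simp only [mul_add, ← Matrix.mul_assoc, projPerp_mul hu, Matrix.zero_mul, zero_add,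
      mul_smul_comm, mul_one, mul_zero] at h
    exact_mod_cast (smul_eq_zero.mp h).resolve_right hP
  have h2 : (fun q => c (.inl q)) = 0 := by
    refine eq_zero_of_hermOfCoord_eq_zero ?_
    rw [h1, Complex.ofReal_zero, zero_smul, add_zero] at hc
    have h : Gᴴ * G * hermOfCoord (fun q => c (.inl q)) * (Gᴴ * G) = 0 := by
      have := congrArg (fun X => Gᴴ * X * G) hc
      simpa only [Matrix.mul_assoc, Matrix.mul_zero, Matrix.zero_mul] using this
    have h3 := congrArg (fun X => (Gᴴ * G)⁻¹ * (X * (Gᴴ * G)⁻¹)) h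
    simpa only [Matrix.mul_nonsing_inv_cancel_right _ _ hu,
      Matrix.nonsing_inv_mul_cancel_left _ _ hu, Matrix.mul_zero, Matrix.zero_mul] using h3
  ext v
  rcases v with q | u
  · exact congrFun h2 q
  · exact h1

/-- The Hermitian matrix whose nuisance direction is the non-orthogonal part of the direction of
a parameter of interest. -/
def nuisancePart {m k : Type*} [Fintype m] [Fintype k] [DecidableEq k] (G D : Matrix m k ℂ)
    (S : Matrix k k ℂ) : Matrix k k ℂ :=
  (Gᴴ * G)⁻¹ * Gᴴ * D * S + S * Dᴴ * G * (Gᴴ * G)⁻¹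

theorem nuisancePart_isHermitian {m k : Type*} [Fintype m] [Fintype k] [DecidableEq k]
    (G D : Matrix m k ℂ) {S : Matrix k k ℂ} (hS : S.IsHermitian) :
    (nuisancePart G D S).IsHermitian := by
  rw [Matrix.IsHermitian, nuisancePart]
  simp only [Matrix.conjTranspose_add, Matrix.conjTranspose_mul,
    Matrix.conjTranspose_conjTranspose, Matrix.conjTranspose_nonsing_inv, hS.eq, Matrix.mul_assoc]
  exact add_comm _ _

/-- Insert 1 = Π + G (Gᴴ G)⁻¹ Gᴴ on the left of D S Gᴴ and on the right of G S Dᴴ. -/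
theorem orthDir_add_nuisancePart {m k : Type*} [Fintype m] [DecidableEq m] [Fintype k]
    [DecidableEq k] (G D : Matrix m k ℂ) (S : Matrix k k ℂ) :
    D * S * Gᴴ + G * S * Dᴴ = orthDir G D S + G * nuisancePart G D S * Gᴴ := by
  simp only [orthDir, nuisancePart, projPerp, Matrix.sub_mul, Matrix.mul_sub, Matrix.one_mul,
    Matrix.mul_one, Matrix.mul_add, Matrix.add_mul, Matrix.mul_assoc]
  abel

theorem fisherInformation_likelihood (L : ℕ) (hr : ∀ k : Fin K₂, η (.inr (2, k)) ≠ 0)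
    (hant : mdl = .spherical → ∀ (k : Fin K₂) (n : Ant Nx Ny),
      antennaRange lam mdl (η (.inr (2, k))) (η (.inr (0, k))) (η (.inr (1, k))) n ≠ 0)
    (hS : S.PosDef) (hσ : 0 < σsq) :
    HasFisherInformation (likelihood Nx Ny L lam mdl) (parVec η S σsq) ∧
      fullFIM Nx Ny L lam mdl η S σsq = Matrix.of fun p q => (L : ℝ) *
        covInner (snapshotCov Nx Ny lam mdl η S σsq) (covDeriv Nx Ny lam mdl η S p)
          (covDeriv Nx Ny lam mdl η S q) := by
  have hM : snapshotCov Nx Ny lam mdl (fun i => parVec η S σsq (.inl i))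
      (hermOfCoord fun q => parVec η S σsq (.inr (.inl q))) (parVec η S σsq (.inr (.inr ()))) =
      snapshotCov Nx Ny lam mdl η S σsq := by
    simp only [parVec, Sum.elim_inl, Sum.elim_inr, hermOfCoord_hermCoord S hS.isHermitian]
  have h := fisherInformation_cn L
    (M := fun ω : ParIdx K₁ K₂ → ℝ => snapshotCov Nx Ny lam mdl
        (fun i => ω (.inl i)) (hermOfCoord fun q => ω (.inr (.inl q))) (ω (.inr (.inr ()))))
    (ω := parVec η S σsq) (by rw [hM]; exact posDef_signal_add_noise _ hS hσ)
    (covDeriv_isHermitian Nx Ny lam mdl η hS.isHermitian)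
    (hasDerivAt_snapshotCov σsq hr hant hS.isHermitian)
  rw [hM] at h
  exact h

theorem isUnit_det_nuisance_fullFIM (hK : K₁ + K₂ < Nx * Ny) {L : ℕ} (hL : 0 < L)
    (hr : ∀ k : Fin K₂, η (.inr (2, k)) ≠ 0)
    (hant : mdl = .spherical → ∀ (k : Fin K₂) (n : Ant Nx Ny),
      antennaRange lam mdl (η (.inr (2, k))) (η (.inr (0, k))) (η (.inr (1, k))) n ≠ 0)
    (hS : S.PosDef) (hσ : 0 < σsq) (hG : LinearIndependent ℂ (asm Nx Ny lam mdl η).col) :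
    IsUnit (fullFIM Nx Ny L lam mdl η S σsq).toBlocks₂₂.det := by
  rw [(fisherInformation_likelihood L hr hant hS hσ).2]
  exact isUnit_det_covInner_gram (B := fun v => covDeriv Nx Ny lam mdl η S (.inr v))
    (posDef_signal_add_noise _ hS hσ)
    (fun v => covDeriv_isHermitian Nx Ny lam mdl η hS.isHermitian _)
    (covDeriv_nuisance_linearIndependent hK hG) (Nat.cast_ne_zero.mpr hL.ne')

theorem efficientInformation_fullFIM (hK : K₁ + K₂ < Nx * Ny) {L : ℕ} (hL : 0 < L)
    (hr : ∀ k : Fin K₂, η (.inr (2, k)) ≠ 0)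
    (hant : mdl = .spherical → ∀ (k : Fin K₂) (n : Ant Nx Ny),
      antennaRange lam mdl (η (.inr (2, k))) (η (.inr (0, k))) (η (.inr (1, k))) n ≠ 0)
    (hS : S.PosDef) (hσ : 0 < σsq) (hG : LinearIndependent ℂ (asm Nx Ny lam mdl η).col) :
    efficientInformation (fullFIM Nx Ny L lam mdl η S σsq) =
      closedFIM Nx Ny lam mdl η S σsq L := by
  have hunit := isUnit_det_nuisance_fullFIM hK hL hr hant hS hσ hG
  have hu := isUnit_det_gram hG
  have hR : IsUnit (snapshotCov Nx Ny lam mdl η S σsq).det :=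
    (Matrix.isUnit_iff_isUnit_det _).mp (posDef_signal_add_noise _ hS hσ).isUnit
  rw [(fisherInformation_likelihood L hr hant hS hσ).2] at hunit ⊢
  rw [efficientInformation_covInner _
    (W := fun i => orthDir (asm Nx Ny lam mdl η) (asmDeriv Nx Ny lam mdl η i) S)
    -- The removed part has the form G H Gᴴ, so it has no component along the noise power: hence the
    -- coefficient `0`.
    (C := Matrix.of fun i => Sum.elim
      (hermCoord (nuisancePart (asm Nx Ny lam mdl η) (asmDeriv Nx Ny lam mdl η i) S)) 0) hunit]
  · ext i j
    -- The swap puts the derivative along `i` on the conjugated side, as in the closed form.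
    rw [Matrix.of_apply, covInner_comm, snapshotCov,
      covInner_orthDir hu hσ.ne' hS.isHermitian hR, closedFIM_apply, ← trace_asmDeriv]
    simp only [qMat, snapshotCov]
    ring
  · intro i
    refine (orthDir_add_nuisancePart _ _ S).trans ?_
    simp only [Matrix.of_apply]
    rw [sum_smul_covDeriv_nuisance]
    simp only [Sum.elim_inl, Sum.elim_inr, Pi.zero_apply, Complex.ofReal_zero, zero_smul, add_zero]
    rw [hermOfCoord_hermCoord _ (nuisancePart_isHermitian _ _ hS.isHermitian)]
  · intro i v
    rcases v with q | u
    · refine covInner_orthDir_eq_zero hu hσ.ne' hR _ (c := 0) ?_ ?_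
      · rw [zero_smul, covDeriv, Matrix.mul_assoc, conjTranspose_mul_projPerp hu, Matrix.mul_zero]
      · rw [zero_smul, covDeriv, ← Matrix.mul_assoc, ← Matrix.mul_assoc, projPerp_mul hu,
          Matrix.zero_mul, Matrix.zero_mul]
    · exact covInner_orthDir_eq_zero hu hσ.ne' hR _ (c := 1)
        (by rw [one_smul, covDeriv, one_mul]) (by rw [one_smul, covDeriv, mul_one])

theorem inv_smul_fim {ι : Type*} [Fintype ι] [DecidableEq ι] {F : Matrix ι ι ℝ}
    (hF : IsUnit F.det) {L : ℕ} (hL : 0 < L) (hσ : 0 < σsq) :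
    IsUnit ((2 * (L : ℝ) / σsq) • F).det ∧
      ((2 * (L : ℝ) / σsq) • F)⁻¹ = (σsq / (2 * (L : ℝ))) • F⁻¹ := by
  have hL' : (0 : ℝ) < L := Nat.cast_pos.mpr hL
  have hc : (2 * (L : ℝ) / σsq) ≠ 0 := by positivity
  have h : ((2 * (L : ℝ) / σsq) • F) * ((σsq / (2 * (L : ℝ))) • F⁻¹) = 1 := by
    rw [smul_mul_smul_comm, Matrix.mul_nonsing_inv _ hF, div_mul_div_comm, mul_comm σsq,
      div_self (by positivity), one_smul]
  exact ⟨Matrix.isUnit_det_of_right_inverse h, Matrix.inv_eq_right_inv h⟩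

end Assembly

end MixedField

end

theorem mainTheorem3 (Nx Ny K₁ K₂ L : ℕ) (hK : K₁ + K₂ < Nx * Ny) (hL : 0 < L)
    (lam : ℝ) (hlam : 0 < lam) (mdl : MixedField.NearModel)
    (η : MixedField.EtaIdx K₁ K₂ → ℝ)
    (hr : ∀ k : Fin K₂, 0 < η (.inr (2, k)))
    (hant : mdl = .spherical → ∀ (k : Fin K₂) (n : MixedField.Ant Nx Ny),
      MixedField.antennaRange lam mdl (η (.inr (2, k))) (η (.inr (0, k))) (η (.inr (1, k))) n ≠ 0)
    (S : Matrix (MixedField.Tgt K₁ K₂) (MixedField.Tgt K₁ K₂) ℂ) (hS : S.PosDef)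
    (σsq : ℝ) (hσ : 0 < σsq)
    (hG : LinearIndependent ℂ (MixedField.asm Nx Ny lam mdl η).col) :
    MixedField.HasFisherInformation
        (MixedField.likelihood Nx Ny L lam mdl) (MixedField.parVec η S σsq) ∧
      IsUnit (MixedField.fullFIM Nx Ny L lam mdl η S σsq).toBlocks₂₂.det ∧
      MixedField.efficientInformation (MixedField.fullFIM Nx Ny L lam mdl η S σsq) =
        MixedField.closedFIM Nx Ny lam mdl η S σsq L ∧
      (IsUnit (MixedField.fullFIM Nx Ny L lam mdl η S σsq).det ↔
        IsUnit (MixedField.closedFIM Nx Ny lam mdl η S σsq L).det) ∧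
      (IsUnit (MixedField.closedFIM Nx Ny lam mdl η S σsq L).det →
        MixedField.stochasticCRB Nx Ny L lam mdl η S σsq =
          (MixedField.closedFIM Nx Ny lam mdl η S σsq L)⁻¹) ∧
      (K₂ = 0 → IsUnit (MixedField.fimFF Nx Ny lam mdl η S σsq).det →
        (MixedField.stochasticCRB Nx Ny L lam mdl η S σsq).toBlocks₁₁ =
          (σsq / (2 * (L : ℝ))) • (MixedField.fimFF Nx Ny lam mdl η S σsq)⁻¹) ∧
      (K₁ = 0 → IsUnit (MixedField.fimNN Nx Ny lam mdl η S σsq).det →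
        (MixedField.stochasticCRB Nx Ny L lam mdl η S σsq).toBlocks₂₂ =
          (σsq / (2 * (L : ℝ))) • (MixedField.fimNN Nx Ny lam mdl η S σsq)⁻¹) := by
  have hr' : ∀ k : Fin K₂, η (.inr (2, k)) ≠ 0 := fun k => (hr k).ne'
  have hfi := (MixedField.fisherInformation_likelihood L hr' hant hS hσ).1
  have hu := MixedField.isUnit_det_nuisance_fullFIM hK hL hr' hant hS hσ hG
  have he := MixedField.efficientInformation_fullFIM hK hL hr' hant hS hσ hG
  have hcrb : IsUnit (MixedField.closedFIM Nx Ny lam mdl η S σsq L).det →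
      MixedField.stochasticCRB Nx Ny L lam mdl η S σsq =
        (MixedField.closedFIM Nx Ny lam mdl η S σsq L)⁻¹ := by
    intro h
    rw [← he] at h ⊢
    exact MixedField.cramerRaoBound_eq_inv hu h
  refine ⟨hfi, hu, he, ?_, hcrb, ?_, ?_⟩
  · rw [← he]
    exact MixedField.isUnit_det_iff_efficientInformation hu
  -- Without near-field targets the far-field block of F is all of F, so inverting it gives the
  -- whole bound.
  · rintro rfl hF
    obtain ⟨h1, h2⟩ := MixedField.inv_smul_fim hF hL hσ
    obtain ⟨h3, h4⟩ := MixedField.inv_toBlocks₁₁_of_isEmpty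
      (MixedField.closedFIM Nx Ny lam mdl η S σsq L) h1
    rw [hcrb h3, h4]
    exact h2
  · rintro rfl hF
    obtain ⟨h1, h2⟩ := MixedField.inv_smul_fim hF hL hσ
    obtain ⟨h3, h4⟩ := MixedField.inv_toBlocks₂₂_of_isEmpty
      (MixedField.closedFIM Nx Ny lam mdl η S σsq L) h1
    rw [hcrb h3, h4]
    exact h2
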